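/- Let $G$ be a finite group, let $\Lambda$ and $I$ be nonempty finite sets, and let $M$ be a $\Lambda\times I$ matrix with entries in $G\cup\{0\}$ that is regular (every row and every column has a nonzero entry). Let $S=\mathcal M(G;M)$ be the Rees matrix semigroup: its elements are $0$ and the triples $[i,g,\lambda]$ with $i\in I$, $g\in G$, $\lambda\in\Lambda$; $[i,g,\lambda][j,h,\gamma]=[i,\,gM(\lambda,j)h,\,\gamma]$ if $M(\lambda,j)\neq 0$, and all other products are $0$. For a finite algebra $A$ let $\mathrm{TERM\text{-}EQ}(A)$ be the decision problem whose instances are pairs of terms $(p,q)$ in the operations of $A$ (multiplication for $S$; multiplication, inversion and the identity element for $G$), written as strings over a finite alphabet, and which asks whether $p$ and $q$ induce the same function on $A$. Write $\leq_P$ for polynomial-time many-one reducibility, and $\equiv_P$ for $\leq_P$ in both directions. 1. $\mathrm{TERM\text{-}EQ}(G)\leq_P\mathrm{TERM\text{-}EQ}(S)$. 2. Suppose that every entry of $M$ is $0$ or the identity element $1$ of $G$. If $G$ is nontrivial, then $\mathrm{TERM\text{-}EQ}(S)\equiv_P\mathrm{TERM\text{-}EQ}(G)$. If $G$ is trivial,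 then $\mathrm{TERM\text{-}EQ}(S)$ and $\mathrm{TERM\text{-}EQ}(G)$ are both in P. -/

import Mathlib

namespace TermEquivalence

/-! ### Decision problems, polynomial time, polynomial-time reductions -/

/-- A decision problem: instances, written as strings over a finite alphabet, together with the
predicate that singles out the instances with answer "yes". -/
structure DecisionProblem where
  Instance : Type
  Symbol : Type
  finite_symbol : Finite Symbol
  encoding : Computability.Encoding Instance Symbol
  Yes : Instance → Prop

/-- `f` is computed by a (multi-stack) Turing machine whose number of steps is bounded by a
polynomial in the length of the string that presents the instance. -/
def PolyTimeMap (A B : DecisionProblem) (f : A.Instance → B.Instance) : Prop :=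
  Nonempty (Turing.TM2ComputableInPolyTime A.encoding.encode B.encoding.encode f)

/-- `A ≤_P B`: polynomial-time (many-one) reduction. -/
def PolyReduces (A B : DecisionProblem) : Prop :=
  ∃ f : A.Instance → B.Instance, PolyTimeMap A B f ∧ ∀ x, A.Yes x ↔ B.Yes (f x)

/-- `A ≡_P B`. -/
def PolyEquivalent (A B : DecisionProblem) : Prop :=
  PolyReduces A B ∧ PolyReduces B A

/-- `A` is in P: a polynomial-time Turing machine writes the truth value of `A.Yes x`. -/
def InP (A : DecisionProblem) : Prop :=
  ∃ d : A.Instance → Bool,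
    Nonempty (Turing.TM2ComputableInPolyTime A.encoding.encode Computability.encodeBool d) ∧
      ∀ x, A.Yes x ↔ d x = true

/-! ### Terms as strings -/

/-- The alphabet in which terms are written: the operation symbols, a marker `none` that starts
the name of a variable, and the two bits `some false`, `some true`. -/
abbrev TermSymbol (L : FirstOrder.Language.{0, 0}) : Type :=
  (Σ i, L.Functions i) ⊕ Option Bool

/-- An operation symbol is written as itself; the variable `x_n` is written as the marker followed
by the binary digits of `n`, least significant digit first. -/
def encodeToken {L : FirstOrder.Language.{0, 0}} : ℕ ⊕ (Σ i, L.Functions i) → List (TermSymbol L)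
  | Sum.inl n => Sum.inr none :: (Computability.encodeNat n).map fun b => Sum.inr (some b)
  | Sum.inr f => [Sum.inl f]

/-- One step of reading a string from right to left: the digits read since the last marker or
operation symbol, and the tokens recognized so far. -/
def readSymbol {L : FirstOrder.Language.{0, 0}} :
    TermSymbol L → List Bool × List (ℕ ⊕ (Σ i, L.Functions i)) →
      List Bool × List (ℕ ⊕ (Σ i, L.Functions i))
  | Sum.inl f, s => ([], Sum.inr f :: s.2)
  | Sum.inr none, s => ([], Sum.inl (Computability.decodeNat s.1) :: s.2)
  | Sum.inr (some b), s => (b :: s.1, s.2)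

theorem foldr_readSymbol_bits {L : FirstOrder.Language.{0, 0}} (l : List Bool)
    (t : List (ℕ ⊕ (Σ i, L.Functions i))) :
    List.foldr readSymbol ([], t) (l.map fun b => (Sum.inr (some b) : TermSymbol L)) = (l, t) := by
  induction l with
  | nil => rfl
  | cons b l ih => rw [List.map_cons, List.foldr_cons, ih]; rfl

theorem foldr_readSymbol {L : FirstOrder.Language.{0, 0}} (t : List (ℕ ⊕ (Σ i, L.Functions i))) :
    List.foldr readSymbol ([], []) (t.flatMap encodeToken) = ([], t) := by
  induction t with
  | nil => rfl
  | cons a t ih =>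
    rw [List.flatMap_cons, List.foldr_append, ih]
    cases a with
    | inl n =>
      rw [encodeToken, List.foldr_cons, foldr_readSymbol_bits]
      simp [readSymbol]
    | inr f => rfl

/-- A term over the variables `x_0, x_1, …` is written in Polish notation (an operation symbol is
followed by its arguments). -/
def termEncoding (L : FirstOrder.Language.{0, 0}) : Computability.Encoding (L.Term ℕ) (TermSymbol L) where
  encode p := p.listEncode.flatMap encodeToken
  decode w := FirstOrder.Language.Term.encoding.decode (List.foldr readSymbol ([], []) w).2
  decode_encode p := by
    rw [foldr_readSymbol]
    exact FirstOrder.Language.Term.encoding.decode_encode p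

/-- `TERM-EQ(A)` for an algebra `A` with finitely many operations: an instance is a pair of terms,
and the question is whether they induce the same function on `A`. -/
def termEq (L : FirstOrder.Language.{0, 0}) [hL : Finite (Σ i, L.Functions i)] (A : Type*) [L.Structure A] :
    DecisionProblem where
  Instance := L.Term ℕ × L.Term ℕ
  Symbol := TermSymbol L ⊕ TermSymbol L
  finite_symbol := inferInstance
  encoding := Computability.encodingProd (termEncoding L) (termEncoding L)
  Yes pq := ∀ e : ℕ → A, pq.1.realize e = pq.2.realize e

/-! ### Semigroups and groups as algebras -/

inductive SemigroupFunc : ℕ → Type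
  | mul : SemigroupFunc 2

/-- The language of semigroups: one binary operation. -/
def semigroupLanguage : FirstOrder.Language.{0, 0} where
  Functions := SemigroupFunc
  Relations := fun _ => Empty

instance : semigroupLanguage.IsAlgebraic := fun _ => inferInstanceAs (IsEmpty Empty)

instance : Finite (Σ i, semigroupLanguage.Functions i) :=
  Finite.of_surjective (fun _ : Unit => (⟨2, SemigroupFunc.mul⟩ : Σ i, SemigroupFunc i))
    (by rintro ⟨_, ⟨⟩⟩; exact ⟨(), rfl⟩)

instance semigroupStructure (S : Type*) [Semigroup S] : semigroupLanguage.Structure S where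
  funMap := fun f => match f with
    | SemigroupFunc.mul => fun a => a 0 * a 1

inductive GroupFunc : ℕ → Type
  | mul : GroupFunc 2
  | inv : GroupFunc 1
  | one : GroupFunc 0

/-- The language of groups: multiplication, inversion, identity element. -/
def groupLanguage : FirstOrder.Language.{0, 0} where
  Functions := GroupFunc
  Relations := fun _ => Empty

instance : groupLanguage.IsAlgebraic := fun _ => inferInstanceAs (IsEmpty Empty)

instance : Finite (Σ i, groupLanguage.Functions i) :=
  Finite.of_surjective
    (fun k : Fin 3 => (![⟨2, GroupFunc.mul⟩, ⟨1, GroupFunc.inv⟩, ⟨0, GroupFunc.one⟩] k :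
      Σ i, GroupFunc i))
    (by
      rintro ⟨_, _ | _ | _⟩
      · exact ⟨0, rfl⟩
      · exact ⟨1, rfl⟩
      · exact ⟨2, rfl⟩)

instance groupStructure (G : Type*) [Group G] : groupLanguage.Structure G where
  funMap := fun f => match f with
    | GroupFunc.mul => fun a => a 0 * a 1
    | GroupFunc.inv => fun a => (a 0)⁻¹
    | GroupFunc.one => fun _ => 1

/-- `TERM-EQ(S)` for a semigroup `S`. -/
abbrev semigroupTermEq (S : Type*) [Semigroup S] : DecisionProblem :=
  termEq semigroupLanguage S

/-- `TERM-EQ(G)` for a group `G`. -/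
abbrev groupTermEq (G : Type*) [Group G] : DecisionProblem :=
  termEq groupLanguage G

/-! ### Rees matrix semigroups -/

/-- Every row and every column has a nonzero entry. -/
def IsRegularMatrix {G I Λ : Type*} (M : Matrix Λ I (WithZero G)) : Prop :=
  (∀ l, ∃ i, M l i ≠ 0) ∧ ∀ i, ∃ l, M l i ≠ 0

/-- Every entry is `0` or the identity element of the group. -/
def IsZeroOneMatrix {G I Λ : Type*} [Group G] (M : Matrix Λ I (WithZero G)) : Prop :=
  ∀ l i, M l i = 0 ∨ M l i = 1

/-- The Rees matrix semigroup `𝓜(G; M)` of a matrix `M` with rows indexed by `Λ`, columns indexed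
by `I` and entries in `G ∪ {0}`: its elements are `0` and the triples `[i, g, l]`. -/
inductive ReesMatrixSemigroup {G I Λ : Type*} (M : Matrix Λ I (WithZero G))
  | zero : ReesMatrixSemigroup M
  | triple (i : I) (g : G) (l : Λ) : ReesMatrixSemigroup M

namespace ReesMatrixSemigroup

variable {G I Λ : Type*} [Group G] {M : Matrix Λ I (WithZero G)}

/-- `[i, g, l][j, h, k] = [i, g M(l, j) h, k]` if `M(l, j) ≠ 0`; all other products are `0`. -/
def mul : ReesMatrixSemigroup M → ReesMatrixSemigroup M → ReesMatrixSemigroup M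
  | triple i g l, triple j h k =>
    match M l j with
    | none => zero
    | some a => triple i (g * a * h) k
  | _, _ => zero

instance : Semigroup (ReesMatrixSemigroup M) where
  mul := mul
  mul_assoc a b c := by
    change mul (mul a b) c = mul a (mul b c)
    rcases a with _ | ⟨i, g, l⟩
    · rfl
    rcases b with _ | ⟨j, h, k⟩
    · rfl
    rcases c with _ | ⟨r, u, s⟩
    · simp only [mul]
      cases M l j <;> rfl
    · simp only [mul]
      rcases h1 : M l j with _ | x <;> rcases h2 : M k r with _ | y <;>
        simp [h1, h2, mul_assoc]

end ReesMatrixSemigroup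

end TermEquivalence

namespace TermEquivalence

open Turing

/-! ### A structured language of stack programs -/

/-! Reduction from `G` to `S`. Choose `K` with `g ^ (K + 2) = 1` on `G` and write group terms as
words in letters and inverse letters. With a new variable `z`, replace `x` by `z x z` and `x⁻¹` by
`(z x z) ^ (K + 1)`. If `z` has the value `[i, t, l]` with `M l i ≠ 0`, every nonzero value of `z x
z` lies in the maximal subgroup at `(i, l)`, a copy of `G`. Both sides receive the same prefix: `z ^
(K + 2)` and the `(K + 2)`-th powers of the blocks of both words. The prefix is `0` as soon as `z *
z` or some `z x z` is `0`, so that both sides vanish together; otherwise it is the identity of the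
subgroup, and the equation becomes the original one over `G` (`forall_prod_substWord_iff`).

Reduction from `S` to `G` for a 0-1 matrix. On nonzero values `[i x, g x, l x]` of the variables a
word is `0` unless `M (l x) (i y) ≠ 0` for all adjacent letters `x y`; otherwise its value consists
of the column index of its first letter, the product of the `g x`, and the row index of its last
letter (`wordValue_triple`). Hence equality over `S` splits into equality over `G` and a condition
on the zero pattern of `M` alone (`forall_wordValue_iff`).

The latter is decided in polynomial time (`exists_wordTest`). If some 2 × 2 submatrix has exactly
one zero, the function determines the set of adjacencies, the first letter and the last letter.
Otherwise the nonzero entries form disjoint rectangular blocks, and a word is nonzero if and only if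
a system of equalities between block labels holds. Implication between such systems is decided by
substitution (`unify_iff`); the first and last letters have to agree, or only their blocks,
according to whether the blocks are wider or higher than one entry. If the test fails, a fixed false
equation over `G` is produced; if it succeeds, the same terms are read over `G`. For trivial `G` the
test is the whole decision.

Polynomial time is established by compiling a small stack language to `TM2` (`Exec.simulate`). Its
programs handle trees in Polish notation; the functions they compute in polynomial time with
polynomial output size (`PT`) are closed under composition, pairing, case distinction and
size-bounded iteration. All string functions above are built from these, and `PT.nonempty_tm2` turns
them into machines. -/

/-- Programs acting on stacks indexed by `K`, the stack `k` having alphabet `Γ k`. -/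
inductive Cmd (K : Type) (Γ : K → Type) : Type
  | skip : Cmd K Γ
  | push (k : K) (a : Γ k) : Cmd K Γ
  | pop (k : K) : Cmd K Γ
  | seq (c d : Cmd K Γ) : Cmd K Γ
  | case (k : K) (f : Option (Γ k) → Cmd K Γ) : Cmd K Γ
  | while (k : K) (p : Option (Γ k) → Bool) (c : Cmd K Γ) : Cmd K Γ

namespace Cmd

variable {K : Type} {Γ : K → Type} [DecidableEq K]

/-- `Exec c s s' t`: started on the stacks `s`, the program `c` ends with the stacks `s'` after at
most `t` steps. -/
inductive Exec : Cmd K Γ → (∀ k, List (Γ k)) → (∀ k, List (Γ k)) → ℕ → Prop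
  | skip {s t} : 1 ≤ t → Exec skip s s t
  | push {k a s t} : 1 ≤ t → Exec (push k a) s (Function.update s k (a :: s k)) t
  | pop {k s t} : 1 ≤ t → Exec (pop k) s (Function.update s k (s k).tail) t
  | seq {c d s₁ s₂ s₃ t₁ t₂ t} : Exec c s₁ s₂ t₁ → Exec d s₂ s₃ t₂ → t₁ + t₂ ≤ t →
      Exec (seq c d) s₁ s₃ t
  | case {k f s s' t₁ t} : Exec (f (s k).head?) s s' t₁ → t₁ + 1 ≤ t → Exec (case k f) s s' t
  | while_true {k p c s₁ s₂ s₃ t₁ t₂ t} : p (s₁ k).head? = true → Exec c s₁ s₂ t₁ →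
      Exec (Cmd.while k p c) s₂ s₃ t₂ → t₁ + t₂ + 1 ≤ t → Exec (Cmd.while k p c) s₁ s₃ t
  | while_false {k p c s t} : p (s k).head? = false → 1 ≤ t → Exec (Cmd.while k p c) s s t

theorem Exec.mono {c : Cmd K Γ} {s s' : ∀ k, List (Γ k)} {t t' : ℕ} (h : Exec c s s' t)
    (ht : t ≤ t') : Exec c s s' t' := by
  cases h with
  | skip h => exact .skip (h.trans ht)
  | push h => exact .push (h.trans ht)
  | pop h => exact .pop (h.trans ht)
  | seq h₁ h₂ h => exact .seq h₁ h₂ (h.trans ht)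
  | case h₁ h => exact .case h₁ (h.trans ht)
  | while_true h₁ h₂ h₃ h => exact .while_true h₁ h₂ h₃ (h.trans ht)
  | while_false h₁ h => exact .while_false h₁ (h.trans ht)

/-! ### Compilation to `TM2` -/

/-- The labels of the compiled program. -/
def Lab : Cmd K Γ → Type
  | skip => Unit
  | push _ _ => Unit
  | pop _ => Unit
  | seq c d => Lab c ⊕ Lab d
  | case _ f => Option (Σ o, Lab (f o))
  | Cmd.while _ _ c => Option (Lab c)

omit [DecidableEq K] in
theorem finite_lab [∀ k, Finite (Γ k)] : ∀ c : Cmd K Γ, Finite (Lab c)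
  | skip => inferInstanceAs (Finite Unit)
  | push _ _ => inferInstanceAs (Finite Unit)
  | pop _ => inferInstanceAs (Finite Unit)
  | seq c d => by
    have := finite_lab c
    have := finite_lab d
    exact inferInstanceAs (Finite (Lab c ⊕ Lab d))
  | case _ f => by
    have := fun o => finite_lab (f o)
    exact inferInstanceAs (Finite (Option (Σ o, Lab (f o))))
  | Cmd.while _ _ c => by
    have := finite_lab c
    exact inferInstanceAs (Finite (Option (Lab c)))

/-- The label at which the compiled program starts. -/
def entry : ∀ c : Cmd K Γ, Lab c
  | skip => ()
  | push _ _ => ()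
  | pop _ => ()
  | seq c _ => Sum.inl (entry c)
  | case _ _ => none
  | Cmd.while _ _ _ => none

/-- The compiled program inside a machine with labels `Λ`; it leaves through the label `exit`. The
internal state of the machine records the symbols seen last on the stacks. -/
def code {Λ : Type} : ∀ c : Cmd K Γ, Λ → (Lab c → Λ) → Lab c →
    TM2.Stmt Γ Λ (∀ k, Option (Γ k))
  | skip, exit, _, _ => .goto fun _ => exit
  | push k a, exit, _, _ => .push k (fun _ => a) (.goto fun _ => exit)
  | pop k, exit, _, _ => .pop k (fun v _ => v) (.goto fun _ => exit)
  | seq c d, _, emb, Sum.inl l => code c (emb (Sum.inr (entry d))) (fun x => emb (Sum.inl x)) l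
  | seq _ d, exit, emb, Sum.inr l => code d exit (fun x => emb (Sum.inr x)) l
  | case k f, _, emb, none =>
    .peek k (fun v o => Function.update v k o) (.goto fun v => emb (some ⟨v k, entry (f (v k))⟩))
  | case _ f, exit, emb, some ⟨o, l⟩ => code (f o) exit (fun x => emb (some ⟨o, x⟩)) l
  | Cmd.while k p c, exit, emb, none =>
    .peek k (fun v o => Function.update v k o)
      (.goto fun v => if p (v k) then emb (some (entry c)) else exit)
  | Cmd.while _ _ c, _, emb, some l => code c (emb none) (fun x => emb (some x)) l

/-- Induction on the execution. Arbitrary `exit` and `emb` let a subprogram sit inside a larger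
machine: the first part of a sequence exits to the entry of the second, a loop body exits to the
loop test. The internal state can be arbitrary because each test overwrites the component that its
jump reads. -/
theorem Exec.simulate {Λ : Type} {m : Λ → TM2.Stmt Γ Λ (∀ k, Option (Γ k))} {c : Cmd K Γ}
    {s s' : ∀ k, List (Γ k)} {t : ℕ} (h : Exec c s s' t) :
    ∀ (exit : Λ) (emb : Lab c → Λ), (∀ l, m (emb l) = code c exit emb l) →
      ∀ v, ∃ v', ∃ n ≤ t, (flip bind (TM2.step m))^[n] (some ⟨some (emb (entry c)), v, s⟩) =
        some ⟨some exit, v', s'⟩ := by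
  induction h with
  | skip ht =>
    intro exit emb hm v
    refine ⟨v, 1, ht, ?_⟩
    simp only [Function.iterate_one, flip, Option.bind_eq_bind, Option.bind_some, TM2.step]
    rw [hm]; rfl
  | push ht =>
    intro exit emb hm v
    refine ⟨v, 1, ht, ?_⟩
    simp only [Function.iterate_one, flip, Option.bind_eq_bind, Option.bind_some, TM2.step]
    rw [hm]; rfl
  | pop ht =>
    intro exit emb hm v
    refine ⟨v, 1, ht, ?_⟩
    simp only [Function.iterate_one, flip, Option.bind_eq_bind, Option.bind_some, TM2.step]
    rw [hm]; rfl
  | @seq c d s₁ s₂ s₃ t₁ t₂ t _ _ ht ih₁ ih₂ =>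
    intro exit emb hm v
    obtain ⟨v₁, n₁, hn₁, h₁⟩ := ih₁ (emb (Sum.inr (entry d))) (fun x => emb (Sum.inl x))
      (fun l => hm _) v
    obtain ⟨v₂, n₂, hn₂, h₂⟩ := ih₂ exit (fun x => emb (Sum.inr x)) (fun l => hm _) v₁
    refine ⟨v₂, n₂ + n₁, by omega, ?_⟩
    rw [Function.iterate_add_apply]
    exact (congrArg _ h₁).trans h₂
  | @case k f s s' t₁ t _ ht ih =>
    intro exit emb hm v
    obtain ⟨v₁, n₁, hn₁, h₁⟩ := ih exit (fun x => emb (some ⟨_, x⟩)) (fun l => hm _)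
      (Function.update v k (s k).head?)
    refine ⟨v₁, n₁ + 1, by omega, ?_⟩
    rw [Function.iterate_add_apply, ← h₁]
    congr 1
    simp only [Function.iterate_one, flip, Option.bind_eq_bind, Option.bind_some, TM2.step]
    rw [hm]
    have key : ∀ o, o = (s k).head? →
        emb (some ⟨o, entry (f o)⟩) = emb (some ⟨(s k).head?, entry (f (s k).head?)⟩) := by
      rintro _ rfl; rfl
    simp [code, entry, key]
  | @while_true k p c s₁ s₂ s₃ t₁ t₂ t hp _ _ ht ih₁ ih₂ =>
    intro exit emb hm v
    obtain ⟨v₁, n₁, hn₁, h₁⟩ := ih₁ (emb none) (fun x => emb (some x)) (fun l => hm _)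
      (Function.update v k (s₁ k).head?)
    obtain ⟨v₂, n₂, hn₂, h₂⟩ := ih₂ exit emb hm v₁
    refine ⟨v₂, n₂ + (n₁ + 1), by omega, ?_⟩
    rw [Function.iterate_add_apply, Function.iterate_add_apply, ← h₂]
    congr 1
    refine Eq.trans ?_ h₁
    congr 1
    simp only [Function.iterate_one, flip, Option.bind_eq_bind, Option.bind_some, TM2.step]
    rw [hm]
    simp [code, entry, hp]
  | @while_false k p c s t hp ht =>
    intro exit emb hm v
    refine ⟨Function.update v k (s k).head?, 1, ht, ?_⟩
    simp only [Function.iterate_one, flip, Option.bind_eq_bind, Option.bind_some, TM2.step]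
    rw [hm]
    simp [code, entry, hp]

/-- The Turing machine that runs a program. -/
noncomputable def toFinTM2 [Fintype K] [∀ k, Finite (Γ k)] (k₀ k₁ : K) (c : Cmd K Γ) : FinTM2 :=
  haveI := finite_lab c
  haveI := Fintype.ofFinite (Lab c)
  haveI := fun k => Fintype.ofFinite (Γ k)
  { K := K
    k₀ := k₀
    k₁ := k₁
    Γ := Γ
    Λ := Option (Lab c)
    main := some (entry c)
    σ := ∀ k, Option (Γ k)
    initialState := fun _ => none
    m := fun l => match l with
      -- `haltList` demands the initial internal state, so it is restored before halting. This costs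
      -- the extra step in the bound `p + 1` below.
      | none => .load (fun _ _ => none) .halt
      | some l => code c none some l }

/-- Stacks all of which are empty, except one. -/
def single (k : K) (l : List (Γ k)) : ∀ k, List (Γ k) := Function.update (fun _ => []) k l

theorem dite_eq_single (k : K) (l : List (Γ k)) (k' : K) :
    (@dite (List (Γ k')) (k' = k) (inferInstance) (fun h => by rw [h]; exact l) fun _ => []) =
      single k l k' := by
  unfold single
  by_cases h : k' = k
  · subst h; simp
  · simp [h]

theorem nonempty_tm2ComputableInPolyTime [Fintype K] [∀ k, Finite (Γ k)] (k₀ k₁ : K)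
    (c : Cmd K Γ) {α β : Type} (ea : α → List (Γ k₀)) (eb : β → List (Γ k₁)) (f : α → β)
    (p : Polynomial ℕ)
    (h : ∀ a, Exec c (single k₀ (ea a)) (single k₁ (eb (f a))) (p.eval (ea a).length)) :
    Nonempty (TM2ComputableInPolyTime ea eb f) := by
  refine ⟨⟨⟨toFinTM2 k₀ k₁ c, Equiv.refl _, Equiv.refl _⟩, p + 1, fun a => ?_⟩⟩
  have hs := (h a).simulate (m := (toFinTM2 k₀ k₁ c).m) none some (fun _ => rfl) (fun _ => none)
  choose v' n hn hs using hs
  refine ⟨⟨1 + n, ?_⟩, ?_⟩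
  · rw [Function.iterate_add_apply]
    have e1 : List.map (Equiv.refl (Γ k₀)).invFun (ea a) = ea a := List.map_id _
    have e2 : List.map (Equiv.refl (Γ k₁)).invFun (eb (f a)) = eb (f a) := List.map_id _
    have h1 : initList (toFinTM2 k₀ k₁ c) (ea a) =
        ⟨some (some (entry c)), fun _ => none, single k₀ (ea a)⟩ := by
      unfold initList
      congr 1
      funext k
      exact dite_eq_single k₀ (ea a) k
    have h2 : haltList (toFinTM2 k₀ k₁ c) (eb (f a)) =
        ⟨none, fun _ => none, single k₁ (eb (f a))⟩ := by
      unfold haltList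
      congr 1
      funext k
      exact dite_eq_single k₁ (eb (f a)) k
    refine Eq.trans (congrArg _ ((congrArg _ (congrArg some ((congrArg _ e1).trans h1))).trans hs)) ?_
    refine Eq.trans ?_ (congrArg some ((congrArg _ e2).trans h2)).symm
    rfl
  · simp only [Polynomial.eval_add, Polynomial.eval_one]
    omega

end Cmd
end TermEquivalence

namespace TermEquivalence

open Turing

/-! ### Trees as data and block operations on stacks -/

/-- Binary trees with finitely many leaf labels: the data type of the programs below. -/
inductive Tree : Type
  | leaf (a : Fin 16) : Tree
  | node (l r : Tree) : Tree

/-- The alphabet of the working stacks. -/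
inductive Sy : Type
  | node : Sy
  | leaf (a : Fin 16) : Sy
  | mark : Sy
  deriving DecidableEq

instance : Finite Sy :=
  Finite.of_surjective
    (fun o : Option (Option (Fin 16)) => match o with
      | none => Sy.node
      | some none => Sy.mark
      | some (some a) => Sy.leaf a)
    (by
      rintro (_ | a | _)
      exacts [⟨none, rfl⟩, ⟨some (some a), rfl⟩, ⟨some none, rfl⟩])

namespace Tree

/-- Trees in Polish notation. -/
def enc : Tree → List Sy
  | leaf a => [Sy.leaf a]
  | node l r => Sy.node :: (enc l ++ enc r)

/-- Therefore a mark placed below a stored tree shows `flush` where the tree ends. -/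
theorem mark_notMem_enc : ∀ t : Tree, Sy.mark ∉ enc t
  | leaf a => by simp [enc]
  | node l r => by simp [enc, mark_notMem_enc l, mark_notMem_enc r]

/-- The number of nodes and leaves. -/
def size (t : Tree) : ℕ := (enc t).length

theorem one_le_size : ∀ t : Tree, 1 ≤ size t
  | leaf a => by simp [size, enc]
  | node l r => by simp [size, enc]

@[simp] theorem size_leaf (a : Fin 16) : size (leaf a) = 1 := rfl

@[simp] theorem size_node (l r : Tree) : size (node l r) = size l + size r + 1 := by
  simp [size, enc]

end Tree

/-- The working stacks: trees are kept on `data`, the others are scratch. -/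
inductive Wk : Type
  | data : Wk
  | left : Wk
  | right : Wk
  | count : Wk
  deriving DecidableEq

instance : Fintype Wk where
  elems := {Wk.data, Wk.left, Wk.right, Wk.count}
  complete := by rintro (_ | _ | _ | _) <;> decide

/-- Programs on the working stacks. -/
abbrev WCmd : Type := Cmd Wk fun _ => Sy

/-- The contents of the working stacks. -/
def St (a b c d : List Sy) : (k : Wk) → List Sy
  | .data => a
  | .left => b
  | .right => c
  | .count => d

namespace St

variable (a b c d x : List Sy)

@[simp] theorem data_eq : St a b c d .data = a := rfl
@[simp] theorem left_eq : St a b c d .left = b := rfl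
@[simp] theorem right_eq : St a b c d .right = c := rfl
@[simp] theorem count_eq : St a b c d .count = d := rfl

@[simp] theorem update_data : Function.update (St a b c d) .data x = St x b c d := by
  funext k; cases k <;> simp [St]
@[simp] theorem update_left : Function.update (St a b c d) .left x = St a x c d := by
  funext k; cases k <;> simp [St]
@[simp] theorem update_right : Function.update (St a b c d) .right x = St a b x d := by
  funext k; cases k <;> simp [St]
@[simp] theorem update_count : Function.update (St a b c d) .count x = St a b c x := by
  funext k; cases k <;> simp [St]

end St

namespace WCmd
open Cmd

variable {a b c d : List Sy} {x y : Sy}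

theorem exec_skip {s : Wk → List Sy} : Exec (skip : WCmd) s s 1 := .skip le_rfl
theorem exec_seq {p q : WCmd} {s₁ s₂ s₃ : Wk → List Sy} {t₁ t₂ : ℕ} (h₁ : Exec p s₁ s₂ t₁)
    (h₂ : Exec q s₂ s₃ t₂) : Exec (seq p q) s₁ s₃ (t₁ + t₂) := .seq h₁ h₂ le_rfl

theorem push_data : Exec (push .data x : WCmd) (St a b c d) (St (x :: a) b c d) 1 := by
  have := @Exec.push Wk (fun _ => Sy) _ .data x (St a b c d) 1 le_rfl
  simpa using this
theorem push_left : Exec (push .left x : WCmd) (St a b c d) (St a (x :: b) c d) 1 := by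
  have := @Exec.push Wk (fun _ => Sy) _ .left x (St a b c d) 1 le_rfl
  simpa using this
theorem push_right : Exec (push .right x : WCmd) (St a b c d) (St a b (x :: c) d) 1 := by
  have := @Exec.push Wk (fun _ => Sy) _ .right x (St a b c d) 1 le_rfl
  simpa using this
theorem push_count : Exec (push .count x : WCmd) (St a b c d) (St a b c (x :: d)) 1 := by
  have := @Exec.push Wk (fun _ => Sy) _ .count x (St a b c d) 1 le_rfl
  simpa using this
theorem pop_data : Exec (pop .data : WCmd) (St (x :: a) b c d) (St a b c d) 1 := by
  have := @Exec.pop Wk (fun _ => Sy) _ .data (St (x :: a) b c d) 1 le_rfl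
  simpa using this
theorem pop_left : Exec (pop .left : WCmd) (St a (x :: b) c d) (St a b c d) 1 := by
  have := @Exec.pop Wk (fun _ => Sy) _ .left (St a (x :: b) c d) 1 le_rfl
  simpa using this
theorem pop_right : Exec (pop .right : WCmd) (St a b (x :: c) d) (St a b c d) 1 := by
  have := @Exec.pop Wk (fun _ => Sy) _ .right (St a b (x :: c) d) 1 le_rfl
  simpa using this
theorem pop_count : Exec (pop .count : WCmd) (St a b c (x :: d)) (St a b c d) 1 := by
  have := @Exec.pop Wk (fun _ => Sy) _ .count (St a b c (x :: d)) 1 le_rfl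
  simpa using this

/-- Remove the symbols of a tree from `data` one by one, doing `act` for each; `count` holds one
symbol for each tree still to be read. -/
def scanLoop (act : Sy → WCmd) : WCmd :=
  .while .count (fun o => o == some Sy.node)
    (.case .data fun o => match o with
      | some Sy.node => .seq (.pop .data) (.seq (act Sy.node) (.push .count Sy.node))
      | some (Sy.leaf i) => .seq (.pop .data) (.seq (act (Sy.leaf i)) (.pop .count))
      | _ => .skip)

/-- Remove a tree from `data`, doing `act` for each of its symbols. -/
def scan (act : Sy → WCmd) : WCmd :=
  -- The mark ends the loop at the right moment, whatever `count` contained before.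
  .seq (.push .count Sy.mark) (.seq (.push .count Sy.node) (.seq (scanLoop act) (.pop .count)))

section scan

variable {act : Sy → WCmd} {f g : List Sy → Sy → List Sy}

/-- Polish notation has no end marker; a tree ends when no subtree is pending. A node turns one
pending subtree into two, a leaf completes one. The hypothesis describes the rest of the run after
`t` has been read, so that for a node the statement for the right subtree is the continuation for
the left one. Each symbol costs five steps. -/
theorem exec_scanLoop
    (h : ∀ x a b c d, Exec (act x) (St a b c d) (St a (f b x) (g c x) d) 1) :
    ∀ (t : Tree) (r b c d : List Sy) (s' : Wk → List Sy) (u : ℕ),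
      Exec (scanLoop act) (St r ((Tree.enc t).foldl f b) ((Tree.enc t).foldl g c) d) s' u →
      Exec (scanLoop act) (St (Tree.enc t ++ r) b c (Sy.node :: d)) s' (5 * t.size + u)
  | .leaf i, r, b, c, d, s', u, H => by
    refine .while_true (t₁ := 4) rfl ?_ H (by simp)
    refine .case (t₁ := 3) ?_ le_rfl
    exact exec_seq pop_data (exec_seq (h _ _ _ _ _) pop_count)
  | .node l r', r, b, c, d, s', u, H => by
    refine .while_true (t₁ := 4) (t₂ := 5 * l.size + (5 * r'.size + u)) rfl
      (.case (t₁ := 3) (exec_seq pop_data (exec_seq (h _ _ _ _ _) push_count)) le_rfl) ?_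
      (by simp; omega)
    have := exec_scanLoop h l (Tree.enc r' ++ r) (f b Sy.node) (g c Sy.node) (Sy.node :: d) _ _
      (exec_scanLoop h r' r _ _ d s' u (by simpa [Tree.enc] using H))
    rw [← List.append_assoc] at this
    exact this

theorem exec_scan
    (h : ∀ x a b c d, Exec (act x) (St a b c d) (St a (f b x) (g c x) d) 1)
    (t : Tree) (r b c d : List Sy) :
    Exec (scan act) (St (Tree.enc t ++ r) b c d)
      (St r ((Tree.enc t).foldl f b) ((Tree.enc t).foldl g c) d) (5 * t.size + 4) :=
  (exec_seq push_count (exec_seq push_count (exec_seq (t₁ := 5 * t.size + 1)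
    (exec_scanLoop h t r b c _ _ _ (.while_false rfl le_rfl)) pop_count))).mono (by omega)

end scan

/-- Remove the symbols above the topmost mark of stack `k`, doing `act` for each, and then that
mark. -/
def flush (k : Wk) (act : Sy → WCmd) : WCmd :=
  .seq (.while k (fun o => o != some Sy.mark)
    (.case k fun o => match o with
      | some x => .seq (.pop k) (act x)
      | _ => .skip)) (.pop k)

theorem exec_flush_left {act : Sy → WCmd} {f g : List Sy → Sy → List Sy} {n : ℕ}
    (h : ∀ x a b c d, Exec (act x) (St a b c d) (St (f a x) b (g c x) d) n) (a c d r : List Sy) :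
    ∀ (w : List Sy), Sy.mark ∉ w →
    Exec (flush .left act) (St a (w ++ Sy.mark :: r) c d) (St (w.foldl f a) r (w.foldl g c) d)
      ((n + 3) * w.length + 2) := by
  intro w hw
  refine .seq (t₁ := (n + 3) * w.length + 1) (s₂ := St (w.foldl f a) (Sy.mark :: r) (w.foldl g c) d)
    (t₂ := 1) ?_ pop_left (by omega)
  induction w generalizing a c with
  | nil => exact .while_false rfl (by omega)
  | cons x w ih =>
    simp only [List.mem_cons, not_or] at hw
    refine .while_true (t₁ := n + 2) ?_ ?_ (ih (f a x) (g c x) hw.2)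
      (by simp only [List.length_cons]; ring_nf; omega)
    · simpa using Ne.symm hw.1
    · exact .case (t₁ := n + 1) ((exec_seq pop_left (h _ _ _ _ _)).mono (by omega)) (by omega)

theorem exec_flush_right {act : Sy → WCmd} {f g : List Sy → Sy → List Sy} {n : ℕ}
    (h : ∀ x a b c d, Exec (act x) (St a b c d) (St (f a x) (g b x) c d) n) (a b d r : List Sy) :
    ∀ (w : List Sy), Sy.mark ∉ w →
    Exec (flush .right act) (St a b (w ++ Sy.mark :: r) d) (St (w.foldl f a) (w.foldl g b) r d)
      ((n + 3) * w.length + 2) := by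
  intro w hw
  refine .seq (t₁ := (n + 3) * w.length + 1) (s₂ := St (w.foldl f a) (w.foldl g b) (Sy.mark :: r) d)
    (t₂ := 1) ?_ pop_right (by omega)
  induction w generalizing a b with
  | nil => exact .while_false rfl (by omega)
  | cons x w ih =>
    simp only [List.mem_cons, not_or] at hw
    refine .while_true (t₁ := n + 2) ?_ ?_ (ih (f a x) (g b x) hw.2)
      (by simp only [List.length_cons]; ring_nf; omega)
    · simpa using Ne.symm hw.1
    · exact .case (t₁ := n + 1) ((exec_seq pop_right (h _ _ _ _ _)).mono (by omega)) (by omega)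

theorem foldl_push (w r : List Sy) : w.foldl (fun r x => x :: r) r = w.reverse ++ r := by
  induction w generalizing r with
  | nil => rfl
  | cons x w ih => simp [ih]

theorem foldl_keep {β : Type} (w : List β) (r : List Sy) : w.foldl (fun r _ => r) r = r := by
  induction w with
  | nil => rfl
  | cons x w ih => simp

/-- Remove the topmost tree. -/
def drop : WCmd := scan fun _ => .skip

theorem exec_drop (t : Tree) (r b c d : List Sy) :
    Exec drop (St (Tree.enc t ++ r) b c d) (St r b c d) (5 * t.size + 4) := by
  have := exec_scan (act := fun _ => .skip) (f := fun r _ => r) (g := fun r _ => r)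
    (fun _ _ _ _ _ => exec_skip) t r b c d
  simp only [foldl_keep] at this
  exact this

/-- Move the topmost tree, reversed, onto a new mark on the stack `left`. -/
def toLeft : WCmd := .seq (.push .left Sy.mark) (scan fun x => .push .left x)

/-- Move the topmost tree, reversed, onto a new mark on the stack `right`. -/
def toRight : WCmd := .seq (.push .right Sy.mark) (scan fun x => .push .right x)

theorem exec_toLeft (t : Tree) (r b c d : List Sy) :
    Exec toLeft (St (Tree.enc t ++ r) b c d)
      (St r ((Tree.enc t).reverse ++ Sy.mark :: b) c d) (5 * t.size + 5) := by
  have := exec_scan (act := fun x => .push .left x) (f := fun r x => x :: r) (g := fun r _ => r)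
    (fun _ _ _ _ _ => push_left) t r (Sy.mark :: b) c d
  rw [foldl_keep, foldl_push] at this
  exact (exec_seq push_left this).mono (by omega)

theorem exec_toRight (t : Tree) (r b c d : List Sy) :
    Exec toRight (St (Tree.enc t ++ r) b c d)
      (St r b ((Tree.enc t).reverse ++ Sy.mark :: c) d) (5 * t.size + 5) := by
  have := exec_scan (act := fun x => .push .right x) (f := fun r _ => r) (g := fun r x => x :: r)
    (fun _ _ _ _ _ => push_right) t r b (Sy.mark :: c) d
  rw [foldl_keep, foldl_push] at this
  exact (exec_seq push_right this).mono (by omega)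

/-- Move the word above the mark of `left` to `data`. -/
def fromLeft : WCmd := flush .left fun x => .push .data x

/-- Move the word above the mark of `right` to `data`. -/
def fromRight : WCmd := flush .right fun x => .push .data x

theorem exec_fromLeft (t : Tree) (r b c d : List Sy) :
    Exec fromLeft (St r ((Tree.enc t).reverse ++ Sy.mark :: b) c d) (St (Tree.enc t ++ r) b c d)
      (4 * t.size + 2) := by
  have := exec_flush_left (act := fun x => .push .data x) (f := fun r x => x :: r)
    (g := fun r _ => r) (n := 1) (fun _ _ _ _ _ => push_data) r c d b (Tree.enc t).reverse
    (by simpa using Tree.mark_notMem_enc t)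
  rw [foldl_keep, foldl_push, List.reverse_reverse, List.length_reverse] at this
  exact this

theorem exec_fromRight (t : Tree) (r b c d : List Sy) :
    Exec fromRight (St r b ((Tree.enc t).reverse ++ Sy.mark :: c) d) (St (Tree.enc t ++ r) b c d)
      (4 * t.size + 2) := by
  have := exec_flush_right (act := fun x => .push .data x) (f := fun r x => x :: r)
    (g := fun r _ => r) (n := 1) (fun _ _ _ _ _ => push_data) r b d c (Tree.enc t).reverse
    (by simpa using Tree.mark_notMem_enc t)
  rw [foldl_keep, foldl_push, List.reverse_reverse, List.length_reverse] at this
  exact this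

/-- Exchange the two topmost trees. -/
def swap : WCmd := .seq toLeft (.seq toRight (.seq fromLeft fromRight))

theorem exec_swap (t u : Tree) (r b c d : List Sy) :
    Exec swap (St (Tree.enc t ++ (Tree.enc u ++ r)) b c d)
      (St (Tree.enc u ++ (Tree.enc t ++ r)) b c d) (9 * (t.size + u.size) + 14) :=
  (exec_seq (exec_toLeft _ _ _ _ _) (exec_seq (exec_toRight _ _ _ _ _)
    (exec_seq (exec_fromLeft _ _ _ _ _) (exec_fromRight _ _ _ _ _)))).mono (by omega)

/-- Duplicate the topmost tree. -/
def dup : WCmd :=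
  .seq toLeft (.seq (.push .right Sy.mark)
    (.seq (flush .left fun x => .seq (.push .data x) (.push .right x))
      -- The copy on `right` is in reading order, so it passes through `left` to be reversed once
      -- before it returns to `data`.
      (.seq (.push .left Sy.mark) (.seq (flush .right fun x => .push .left x) fromLeft))))

theorem exec_dup (t : Tree) (r b c d : List Sy) :
    Exec dup (St (Tree.enc t ++ r) b c d)
      (St (Tree.enc t ++ (Tree.enc t ++ r)) b c d) (18 * t.size + 13) := by
  have h₁ := exec_flush_left (act := fun x => .seq (.push .data x) (.push .right x))
    (f := fun r x => x :: r) (g := fun r x => x :: r) (n := 2)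
    (fun _ _ _ _ _ => exec_seq push_data push_right) r (Sy.mark :: c) d b (Tree.enc t).reverse
    (by simpa using Tree.mark_notMem_enc t)
  have h₂ := exec_flush_right (act := fun x => .push .left x)
    (f := fun r _ => r) (g := fun r x => x :: r) (n := 1)
    (fun _ _ _ _ _ => push_left) (Tree.enc t ++ r) (Sy.mark :: b) d c (Tree.enc t)
    (Tree.mark_notMem_enc t)
  rw [foldl_push, foldl_push, List.reverse_reverse] at h₁
  rw [foldl_push, foldl_keep] at h₂
  refine (exec_seq (exec_toLeft _ _ _ _ _) (exec_seq push_right (exec_seq h₁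
    (exec_seq push_left (exec_seq h₂ (exec_fromLeft _ _ _ _ _)))))).mono ?_
  simp only [List.length_reverse]
  change _ + (1 + ((2 + 3) * t.size + 2 + (1 + ((1 + 3) * t.size + 2 + _)))) ≤ _
  omega

/-- Push a word, its last symbol first. -/
def pushAll : List Sy → WCmd
  | [] => .skip
  | x :: w => .seq (pushAll w) (.push .data x)

theorem exec_pushAll (r b c d : List Sy) : ∀ w : List Sy,
    Exec (pushAll w) (St r b c d) (St (w ++ r) b c d) (w.length + 1)
  | [] => exec_skip
  | _ :: w => exec_seq (exec_pushAll r b c d w) push_data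

end WCmd
end TermEquivalence

namespace TermEquivalence

open Turing
open Cmd WCmd

/-! ### Polynomial-time functions on types represented by trees -/

/-- A representation of the elements of a type by trees. -/
class Rep (α : Type) where
  toTree : α → Tree

/-- A representation by leaves. -/
class FinRep (α : Type) where
  code : α → Fin 16
  decode : Fin 16 → α
  decode_code : ∀ a, decode (code a) = a

instance finRepRep (α : Type) [FinRep α] : Rep α := ⟨fun a => .leaf (FinRep.code a)⟩

/-- The representing tree of a list. -/
def listTree {α : Type} [Rep α] : List α → Tree
  | [] => .leaf 0
  | a :: l => .node (Rep.toTree a) (listTree l)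

instance (α : Type) [Rep α] : Rep (List α) := ⟨listTree⟩

instance (α β : Type) [Rep α] [Rep β] : Rep (α × β) :=
  ⟨fun x => .node (Rep.toTree x.1) (Rep.toTree x.2)⟩

/-- The size of the representing tree. -/
def sz {α : Type} [Rep α] (a : α) : ℕ := (Rep.toTree a).size

section sz

variable {α β : Type} [Rep α] [Rep β]

theorem one_le_sz (a : α) : 1 ≤ sz a := Tree.one_le_size _

@[simp] theorem sz_finRep {α : Type} [FinRep α] (a : α) : sz a = 1 := rfl

@[simp] theorem sz_pair (a : α) (b : β) : sz (a, b) = sz a + sz b + 1 := Tree.size_node _ _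

@[simp] theorem sz_nil : sz ([] : List α) = 1 := rfl

@[simp] theorem sz_cons (a : α) (l : List α) : sz (a :: l) = sz a + sz l + 1 :=
  Tree.size_node _ _

theorem length_lt_sz (l : List α) : l.length < sz l := by
  induction l with
  | nil => simp
  | cons a l ih => simp; omega

theorem sz_append (l m : List α) : sz (l ++ m) + 1 = sz l + sz m := by
  induction l with
  | nil => simp; omega
  | cons a l ih => simp; omega

theorem sz_reverse (l : List α) : sz l.reverse = sz l := by
  induction l with
  | nil => simp
  | cons a l ih =>
    have := sz_append l.reverse [a]
    simp at this ⊢; omega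

theorem sz_drop_le (l : List α) (k : ℕ) : sz (l.drop k) ≤ sz l := by
  induction k generalizing l with
  | zero => simp
  | succ k ih =>
    cases l with
    | nil => simp
    | cons a l => exact (ih l).trans (by simp; omega)

theorem sz_le_of_mem {a : α} {l : List α} (h : a ∈ l) : sz a ≤ sz l := by
  induction l with
  | nil => simp at h
  | cons b l ih =>
    rcases List.mem_cons.1 h with rfl | h
    · simp; omega
    · have := ih h; simp; omega

theorem sz_le_of_forall {l : List α} {m : ℕ} (h : ∀ a ∈ l, sz a ≤ m) :
    sz l ≤ l.length * (m + 1) + 1 := by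
  induction l with
  | nil => simp
  | cons b l ih =>
    have h1 := ih fun a ha => h a (List.mem_cons_of_mem _ ha)
    have h2 := h b List.mem_cons_self
    simp only [sz_cons, List.length_cons, add_mul, one_mul]
    omega

end sz

theorem eval_mono (p : Polynomial ℕ) {m n : ℕ} (h : m ≤ n) : p.eval m ≤ p.eval n := by
  rw [Polynomial.eval_eq_sum, Polynomial.eval_eq_sum]
  exact Finset.sum_le_sum fun i _ => Nat.mul_le_mul_left _ (Nat.pow_le_pow_left h i)

/-- The program `c` replaces the topmost tree `x` by `y` in time `t`, whatever lies below. -/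
def Computes (c : WCmd) (x y : Tree) (t : ℕ) : Prop :=
  ∀ r b c' d, Exec c (St (x.enc ++ r) b c' d) (St (y.enc ++ r) b c' d) t

/-- `f` is computed by a program in polynomial time, and the size of its values is polynomially
bounded. -/
def PT {α β : Type} [Rep α] [Rep β] (f : α → β) : Prop :=
  ∃ (c : WCmd) (p : Polynomial ℕ), ∀ x,
    Computes c (Rep.toTree x) (Rep.toTree (f x)) (p.eval (sz x)) ∧ sz (f x) ≤ p.eval (sz x)

namespace PT

variable {α β γ δ : Type} [Rep α] [Rep β] [Rep γ] [Rep δ]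

theorem intro {f : α → β} (c : WCmd) (p q : Polynomial ℕ)
    (h : ∀ x, Computes c (Rep.toTree x) (Rep.toTree (f x)) (p.eval (sz x)))
    (h' : ∀ x, sz (f x) ≤ q.eval (sz x)) : PT f :=
  ⟨c, p + q, fun x => ⟨fun r b c' d => (h x r b c' d).mono (by simp),
    (h' x).trans (by simp)⟩⟩

theorem of_eq {f g : α → β} (h : PT f) (e : ∀ x, f x = g x) : PT g := by
  have : f = g := funext e
  exact this ▸ h

theorem bound {f : α → β} (h : PT f) : ∃ p : Polynomial ℕ, ∀ x, sz (f x) ≤ p.eval (sz x) :=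
  let ⟨_, p, h⟩ := h
  ⟨p, fun x => (h x).2⟩

protected theorem id : PT (fun x : α => x) :=
  intro .skip 1 Polynomial.X (fun _ _ _ _ _ => by simpa using exec_skip) (by simp)

/-- The time of `g` is measured by the size of `f x`; this is why `PT` also bounds the size of
values. -/
theorem comp {g : β → γ} {f : α → β} (hg : PT g) (hf : PT f) : PT (fun x => g (f x)) := by
  obtain ⟨cg, pg, hg⟩ := hg
  obtain ⟨cf, pf, hf⟩ := hf
  refine intro (.seq cf cg) (pf + pg.comp pf) (pg.comp pf) (fun x r b c d => ?_) fun x => ?_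
  · refine (exec_seq ((hf x).1 r b c d) ((hg (f x)).1 r b c d)).mono ?_
    have := eval_mono pg (hf x).2
    simpa using this
  · have := eval_mono pg (hf x).2
    simpa using (hg (f x)).2.trans this

theorem pair {f : α → β} {g : α → γ} (hf : PT f) (hg : PT g) : PT (fun x => (f x, g x)) := by
  obtain ⟨cf, pf, hf⟩ := hf
  obtain ⟨cg, pg, hg⟩ := hg
  refine intro (.seq dup (.seq cg (.seq swap (.seq cf (.push .data Sy.node)))))
    (27 * Polynomial.X + 28 + 10 * pg + pf) (pf + pg + 1) (fun x r b c d => ?_) fun x => ?_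
  · have h := exec_seq (exec_dup (Rep.toTree x) r b c d)
      (exec_seq ((hg x).1 _ b c d) (exec_seq (exec_swap (Rep.toTree (g x)) (Rep.toTree x) r b c d)
      (exec_seq ((hf x).1 _ b c d) (push_data (x := Sy.node)))))
    have h2 := (hg x).2
    have e : (Rep.toTree (f x, g x)).enc ++ r =
        Sy.node :: ((Rep.toTree (f x)).enc ++ ((Rep.toTree (g x)).enc ++ r)) := by
      simp [Rep.toTree, Tree.enc]
    rw [e]
    refine h.mono ?_
    simp only [Polynomial.eval_add, Polynomial.eval_mul, Polynomial.eval_X, Polynomial.eval_ofNat]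
    simp only [sz] at h2 ⊢
    omega
  · have h1 := (hf x).2
    have h2 := (hg x).2
    simp only [Polynomial.eval_add, sz_pair, Polynomial.eval_one]
    omega

protected theorem fst : PT (fun x : α × β => x.1) := by
  refine intro (.seq (.pop .data) (.seq swap drop)) (14 * Polynomial.X + 20) Polynomial.X
    (fun x r b c d => ?_) fun x => ?_
  · have h := exec_seq (pop_data (x := Sy.node)) (exec_seq
      (exec_swap (Rep.toTree x.1) (Rep.toTree x.2) r b c d) (exec_drop _ _ b c d))
    have e : (Rep.toTree x).enc ++ r =
        Sy.node :: ((Rep.toTree x.1).enc ++ ((Rep.toTree x.2).enc ++ r)) := by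
      simp [Rep.toTree, Tree.enc]
    rw [e]
    refine h.mono ?_
    rcases x with ⟨x, y⟩
    simp only [Polynomial.eval_add, Polynomial.eval_mul, Polynomial.eval_X, Polynomial.eval_ofNat,
      sz_pair]
    simp only [sz]
    omega
  · rcases x with ⟨x, y⟩
    simp; omega

protected theorem snd : PT (fun x : α × β => x.2) := by
  refine intro (.seq (.pop .data) drop) (5 * Polynomial.X + 5) Polynomial.X
    (fun x r b c d => ?_) fun x => ?_
  · have h := exec_seq (pop_data (x := Sy.node)) (exec_drop (Rep.toTree x.1) ((Rep.toTree x.2).enc ++ r) b c d)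
    have e : (Rep.toTree x).enc ++ r =
        Sy.node :: ((Rep.toTree x.1).enc ++ ((Rep.toTree x.2).enc ++ r)) := by
      simp [Rep.toTree, Tree.enc]
    rw [e]
    refine h.mono ?_
    rcases x with ⟨x, y⟩
    simp only [Polynomial.eval_add, Polynomial.eval_mul, Polynomial.eval_X, Polynomial.eval_ofNat,
      sz_pair]
    simp only [sz]
    omega
  · rcases x with ⟨x, y⟩
    simp; omega

protected theorem const (y : β) : PT (fun _ : α => y) := by
  refine intro (.seq drop (pushAll (Rep.toTree y).enc))
    (5 * Polynomial.X + 4 + Polynomial.C ((Rep.toTree y).enc.length + 1)) (Polynomial.C (sz y))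
    (fun x r b c d => ?_) fun x => ?_
  · refine (exec_seq (exec_drop (Rep.toTree x) r b c d) (exec_pushAll _ _ _ _ _)).mono ?_
    simp [sz]
  · simp

theorem fst' {f : α → β × γ} (h : PT f) : PT (fun x => (f x).1) := PT.fst.comp h
theorem snd' {f : α → β × γ} (h : PT f) : PT (fun x => (f x).2) := PT.snd.comp h

/-- A nonempty list and the pair of its head and tail have the same tree, so the program for `pair`
serves unchanged. -/
theorem cons {f : α → β} {g : α → List β} (hf : PT f) (hg : PT g) : PT (fun x => f x :: g x) :=
  let ⟨c, p, h⟩ := pair hf hg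
  ⟨c, p, h⟩

/-- Case distinction on an element of a finite type. -/
theorem dispatch {ι : Type} [FinRep ι] {i : α → ι} {g : ι → α → β} (hi : PT i)
    (hg : ∀ a, PT (g a)) : PT (fun x => g (i x) x) := by
  suffices PT (fun x : ι × α => g x.1 x.2) from this.comp (hi.pair PT.id)
  choose c p h using hg
  refine intro (.seq (.pop .data) (.case .data fun o => match o with
      | some (Sy.leaf j) => .seq (.pop .data) (c (FinRep.decode j))
      | _ => .skip))
    (3 + ∑ j, p (FinRep.decode j)) (∑ j, p (FinRep.decode j)) (fun x r b c' d => ?_) fun x => ?_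
  · rcases x with ⟨a, x⟩
    refine .seq pop_data (t₂ := 2 + (p a).eval (sz x)) ?_ ?_
    · refine .case (t₁ := 1 + (p a).eval (sz x)) ?_ (by omega)
      change Exec (.seq (.pop .data) (c (FinRep.decode (FinRep.code a)))) _ _ _
      rw [FinRep.decode_code]
      exact exec_seq pop_data ((h a x).1 _ _ _ _)
    · simp only [Polynomial.eval_add, Polynomial.eval_ofNat, Polynomial.eval_finsetSum]
      have h1 : (p a).eval (sz x) ≤ (p a).eval (sz (a, x)) := eval_mono _ (by simp; omega)
      have h2 := Finset.single_le_sum (f := fun j => (p (FinRep.decode j)).eval (sz (a, x)))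
        (fun _ _ => Nat.zero_le _) (Finset.mem_univ (FinRep.code a))
      simp only [FinRep.decode_code] at h2
      omega
  · rcases x with ⟨a, x⟩
    simp only [Polynomial.eval_finsetSum]
    have h1 : (p a).eval (sz x) ≤ (p a).eval (sz (a, x)) := eval_mono _ (by simp; omega)
    have h2 := Finset.single_le_sum (f := fun j => (p (FinRep.decode j)).eval (sz (a, x)))
      (fun _ _ => Nat.zero_le _) (Finset.mem_univ (FinRep.code a))
    simp only [FinRep.decode_code] at h2
    exact ((h a x).2.trans h1).trans h2

/-- Case distinction on a list. -/
theorem listCases {l : α → List β} {f : α → γ} {g : α → β → List β → γ} (hl : PT l) (hf : PT f)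
    (hg : PT (fun x : (β × List β) × α => g x.2 x.1.1 x.1.2)) :
    PT (fun x => match l x with
      | [] => f x
      | b :: m => g x b m) := by
  suffices PT (fun x : List β × α => match x.1 with
      | [] => f x.2
      | b :: m => g x.2 b m) from this.comp (hl.pair PT.id)
  obtain ⟨cf, pf, hf⟩ := hf
  obtain ⟨cg, pg, hg⟩ := hg
  refine intro (.seq (.pop .data) (.case .data fun o => match o with
      | some (Sy.leaf _) => .seq (.pop .data) cf
      -- Here the stack holds the tree of `y :: l` above that of `x`; restoring the node turns it
      -- into the tree of `((y, l), x)`.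
      | some Sy.node => .seq (.push .data Sy.node) cg
      | _ => .skip))
    (3 + pf + pg) (pf + pg) (fun x r b c' d => ?_) fun x => ?_
  · rcases x with ⟨_ | ⟨y, l⟩, x⟩
    · refine .seq pop_data (t₂ := 2 + pf.eval (sz x)) ?_ ?_
      · refine .case (t₁ := 1 + pf.eval (sz x)) ?_ (by omega)
        exact exec_seq pop_data ((hf x).1 _ _ _ _)
      · have h1 : pf.eval (sz x) ≤ pf.eval (sz (([] : List β), x)) := eval_mono _ (by simp; omega)
        simp only [Polynomial.eval_add, Polynomial.eval_ofNat]
        omega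
    · refine .seq pop_data (t₂ := 2 + pg.eval (sz (y :: l, x))) ?_ ?_
      · refine .case (t₁ := 1 + pg.eval (sz (y :: l, x))) ?_ (by omega)
        exact exec_seq push_data ((hg ((y, l), x)).1 _ _ _ _)
      · simp only [Polynomial.eval_add, Polynomial.eval_ofNat]
        omega
  · rcases x with ⟨_ | ⟨y, l⟩, x⟩
    · have h1 : pf.eval (sz x) ≤ pf.eval (sz (([] : List β), x)) := eval_mono _ (by simp; omega)
      have := (hf x).2
      simp only [Polynomial.eval_add]
      omega
    · have : sz (g x y l) ≤ pg.eval (sz (y :: l, x)) := (hg ((y, l), x)).2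
      simp only [Polynomial.eval_add]
      omega

/-- Iterate the function computed by `c`, once for each element of the list on top. -/
def iterLoop (c : WCmd) : WCmd :=
  .while .data (fun o => o == some Sy.node)
    (.seq (.pop .data) (.seq drop (.seq swap (.seq c swap))))

/-- The list is a unary counter: each round drops its head and swaps the tail out of the way to
apply `c`. `L` bounds the lists and `B` all iterates, so one bound serves every round; without such
a `B` iterates could grow exponentially. -/
theorem exec_iterLoop {f : α → α} {c : WCmd} {p : Polynomial ℕ}
    (hc : ∀ x, Computes c (Rep.toTree x) (Rep.toTree (f x)) (p.eval (sz x))) (L B : ℕ)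
    (r b c' d : List Sy) : ∀ (l : List β) (x : α), sz l ≤ L →
      (∀ k ≤ l.length, sz (f^[k] x) ≤ B) →
      Exec (iterLoop c) (St ((Rep.toTree l).enc ++ ((Rep.toTree x).enc ++ r)) b c' d)
        (St (Sy.leaf 0 :: ((Rep.toTree (f^[l.length] x)).enc ++ r)) b c' d)
        (l.length * (23 * L + 18 * B + 34 + p.eval B) + 1)
  | [], x, _, _ => .while_false rfl (by simp)
  | y :: l, x, hL, hB => by
    have hx := hB 0 (by simp)
    have hfx := hB 1 (by simp)
    simp only [Function.iterate_zero, id, Function.iterate_one] at hx hfx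
    simp only [sz_cons] at hL
    have e : (Rep.toTree (y :: l)).enc ++ ((Rep.toTree x).enc ++ r) = Sy.node ::
        ((Rep.toTree y).enc ++ ((Rep.toTree l).enc ++ ((Rep.toTree x).enc ++ r))) := by
      simp [Rep.toTree, listTree, Tree.enc]
    rw [e]
    refine .while_true rfl (exec_seq pop_data (exec_seq (exec_drop _ _ _ _ _)
      (exec_seq (exec_swap _ _ _ _ _ _) (exec_seq (hc x _ _ _ _) (exec_swap _ _ _ _ _ _)))))
      (exec_iterLoop hc L B r b c' d l (f x) (by omega) fun k hk => ?_) ?_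
    · have := hB (k + 1) (by simpa using hk)
      rwa [Function.iterate_succ_apply] at this
    · have hp := eval_mono p hx
      simp only [sz] at hx hfx hL hp ⊢
      simp only [List.length_cons, add_mul, one_mul]
      omega

/-- Iteration, with a polynomial bound on the size of the intermediate values. -/
theorem iterate {l : γ → List β} {s : γ → α} {f : α → α} (hl : PT l) (hs : PT s) (hf : PT f)
    (B : Polynomial ℕ) (hB : ∀ x, ∀ k ≤ (l x).length, sz (f^[k] (s x)) ≤ B.eval (sz x)) :
    PT (fun x => f^[(l x).length] (s x)) := by
  obtain ⟨c₁, p₁, h₁⟩ := hl.pair hs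
  obtain ⟨c, p, h⟩ := hf
  refine intro (.seq c₁ (.seq (.pop .data) (.seq (iterLoop c) (.pop .data))))
    (p₁ + 3 + p₁ * (23 * p₁ + 18 * B + 34 + p.comp B)) B (fun x r b c' d => ?_)
    (fun x => hB x _ le_rfl)
  have hsz := (h₁ x).2
  simp only [sz_pair] at hsz
  have h2 := exec_iterLoop (fun x => (h x).1) (p₁.eval (sz x)) (B.eval (sz x)) r b c' d (l x) (s x)
    (by omega) (hB x)
  have e : (Rep.toTree (l x, s x)).enc ++ r =
      Sy.node :: ((Rep.toTree (l x)).enc ++ ((Rep.toTree (s x)).enc ++ r)) := by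
    simp [Rep.toTree, Tree.enc]
  have h3 := (h₁ x).1 r b c' d
  rw [e] at h3
  refine (exec_seq h3 (exec_seq pop_data (exec_seq h2 pop_data))).mono ?_
  have hlen : (l x).length ≤ p₁.eval (sz x) := by
    have := length_lt_sz (l x)
    omega
  have := Nat.mul_le_mul_right
    (23 * p₁.eval (sz x) + 18 * B.eval (sz x) + 34 + p.eval (B.eval (sz x))) hlen
  simp only [Polynomial.eval_add, Polynomial.eval_mul, Polynomial.eval_ofNat, Polynomial.eval_comp]
  omega

end PT
end TermEquivalence

/-! ### Closure of polynomial time under list operations and equality tests. -/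

namespace TermEquivalence

open Turing
open Cmd WCmd

instance : FinRep Bool where
  code b := if b then 1 else 0
  decode i := i == 1
  decode_code := by decide

namespace PT

variable {α β γ δ : Type} [Rep α] [Rep β] [Rep γ] [Rep δ]

/-- A fold over a list, with a polynomial bound on the size of the intermediate values. -/
theorem foldl {l : α → List β} {s : α → γ} {h : α → γ → β → γ} (hl : PT l) (hs : PT s)
    (hh : PT (fun x : α × γ × β => h x.1 x.2.1 x.2.2)) (b : Polynomial ℕ)
    (hb : ∀ x m, m <+: l x → sz (m.foldl (h x) (s x)) ≤ b.eval (sz x)) :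
    PT (fun x => (l x).foldl (h x) (s x)) := by
  -- The state carries the environment, the unread part of the list and the accumulator. It is
  -- stationary once the list is used up.
  let step : α × List β × γ → α × List β × γ := fun x => match x.2.1 with
    | [] => x
    | y :: m => (x.1, m, h x.1 x.2.2 y)
  have hstep : PT step := by
    refine listCases (f := fun x => x) (g := fun x y m => (x.1, m, h x.1 x.2.2 y))
      PT.snd.fst' PT.id ?_
    exact PT.snd.fst'.pair (PT.fst.snd'.pair
      (hh.comp (PT.snd.fst'.pair (PT.snd.snd'.snd'.pair PT.fst.fst'))))
  have key : ∀ (k : ℕ) (e : α) (m : List β) (c : γ),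
      step^[k] (e, m, c) = (e, m.drop k, (m.take k).foldl (h e) c) := by
    intro k
    induction k with
    | zero => intros; rfl
    | succ k ih =>
      intro e m c
      cases m with
      | nil =>
        have h1 : step (e, [], c) = (e, [], c) := rfl
        rw [Function.iterate_succ_apply, h1, ih]
        simp
      | cons y m =>
        have h1 : step (e, y :: m, c) = (e, m, h e c y) := rfl
        rw [Function.iterate_succ_apply, h1, ih]
        simp
  obtain ⟨pl, hpl⟩ := hl.bound
  have := iterate (s := fun x => (x, l x, s x)) hl (PT.id.pair (hl.pair hs)) hstep
    (Polynomial.X + pl + b + 2) (fun x k _ => by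
      rw [key]
      have h1 := hb x _ (List.take_prefix k (l x))
      have h2 := sz_drop_le (l x) k
      have h3 := hpl x
      simp only [sz_pair, Polynomial.eval_add, Polynomial.eval_X, Polynomial.eval_ofNat]
      omega)
  exact (this.snd'.snd').of_eq fun x => by simp [key]

/-- A fold over a list each step of which adds a bounded amount to the size. -/
theorem foldl_add {l : α → List β} {s : α → γ} {h : α → γ → β → γ} (hl : PT l) (hs : PT s)
    (hh : PT (fun x : α × γ × β => h x.1 x.2.1 x.2.2)) (b : Polynomial ℕ)
    (hb : ∀ x c, ∀ y ∈ l x, sz (h x c y) ≤ sz c + b.eval (sz x)) :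
    PT (fun x => (l x).foldl (h x) (s x)) := by
  obtain ⟨pl, hpl⟩ := hl.bound
  obtain ⟨ps, hps⟩ := hs.bound
  refine foldl hl hs hh (ps + pl * b) fun x m hm => ?_
  have key : ∀ (m : List β), m ⊆ l x → ∀ c, sz (m.foldl (h x) c) ≤ sz c + m.length * b.eval (sz x) := by
    intro m
    induction m with
    | nil => simp
    | cons y m ih =>
      intro hm c
      have h1 := ih (fun z hz => hm (List.mem_cons_of_mem _ hz)) (h x c y)
      have h2 := hb x c y (hm List.mem_cons_self)
      simp only [List.foldl_cons, List.length_cons, add_mul, one_mul]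
      omega
  have h1 := key m hm.subset (s x)
  have h2 := hps x
  have h3 : m.length ≤ pl.eval (sz x) :=
    (hm.length_le.trans (length_lt_sz _).le).trans (hpl x)
  have h4 := Nat.mul_le_mul_right (b.eval (sz x)) h3
  simp only [Polynomial.eval_add, Polynomial.eval_mul]
  omega

theorem reverse : PT (fun l : List α => l.reverse) := by
  have := foldl_add (l := fun l : List α => l) (s := fun _ => []) (h := fun _ c y => y :: c)
    PT.id (PT.const _) (PT.snd.snd'.cons PT.snd.fst') (Polynomial.X + 1) (fun x c y hy => by
      have := sz_le_of_mem hy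
      simp; omega)
  refine this.of_eq fun l => ?_
  simp

theorem append {f g : α → List β} (hf : PT f) (hg : PT g) : PT (fun x => f x ++ g x) := by
  suffices PT (fun x : List β × List β => x.1 ++ x.2) from this.comp (hf.pair hg)
  have := foldl_add (l := fun x : List β × List β => x.1.reverse) (s := fun x => x.2)
    (h := fun _ c y => y :: c) (PT.reverse.comp PT.fst) PT.snd (PT.snd.snd'.cons PT.snd.fst')
    (Polynomial.X + 1) (fun x c y hy => by
      have := sz_le_of_mem (List.mem_reverse.1 hy)
      rcases x with ⟨l, m⟩
      simp at this ⊢; omega)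
  refine this.of_eq fun x => ?_
  simp

theorem flatMap {l : α → List β} {f : α → β → List γ} (hl : PT l)
    (hf : PT (fun x : α × β => f x.1 x.2)) : PT (fun x => (l x).flatMap (f x)) := by
  obtain ⟨p, hp⟩ := hf.bound
  obtain ⟨q, hq⟩ := hl.bound
  have := foldl_add (l := l) (s := fun _ => []) (h := fun x c y => c ++ f x y) hl (PT.const _)
    (PT.snd.fst'.append (hf.comp (PT.fst.pair PT.snd.snd'))) (p.comp (Polynomial.X + q + 1))
    (fun x c y hy => by
      have h1 := sz_append c (f x y)
      have h2 : sz (f x y) ≤ _ := hp (x, y)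
      have h3 := (sz_le_of_mem hy).trans (hq x)
      have h4 := eval_mono p (show sz (x, y) ≤ sz x + q.eval (sz x) + 1 by simp; omega)
      simp only [Polynomial.eval_comp, Polynomial.eval_add, Polynomial.eval_X,
        Polynomial.eval_one]
      omega)
  refine this.of_eq fun x => ?_
  have : ∀ (m : List β) (c : List γ), m.foldl (fun c y => c ++ f x y) c = c ++ m.flatMap (f x) := by
    intro m
    induction m with
    | nil => simp
    | cons y m ih => intro c; simp [ih]
  simpa using this (l x) []

theorem map {l : α → List β} {f : α → β → γ} (hl : PT l)
    (hf : PT (fun x : α × β => f x.1 x.2)) : PT (fun x => (l x).map (f x)) :=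
  (flatMap (f := fun x y => [f x y]) hl (hf.cons (PT.const []))).of_eq fun x => by
    rw [List.map_eq_flatMap]

/-- A fold from the right each step of which adds a bounded amount to the size. -/
theorem foldr_add {l : α → List β} {s : α → γ} {h : α → β → γ → γ} (hl : PT l) (hs : PT s)
    (hh : PT (fun x : α × β × γ => h x.1 x.2.1 x.2.2)) (b : Polynomial ℕ)
    (hb : ∀ x c, ∀ y ∈ l x, sz (h x y c) ≤ sz c + b.eval (sz x)) :
    PT (fun x => (l x).foldr (h x) (s x)) := by
  have := foldl_add (h := fun x c y => h x y c) (PT.reverse.comp hl) hs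
    (hh.comp (PT.fst.pair (PT.snd.snd'.pair PT.snd.fst'))) b
    (fun x c y hy => hb x c y (List.mem_reverse.1 hy))
  exact this.of_eq fun x => by simp

theorem ofFin {ι : Type} [FinRep ι] (f : ι → α) : PT f :=
  dispatch (g := fun a _ => f a) PT.id fun _ => PT.const _

protected theorem cond {c : α → Bool} {f g : α → β} (hc : PT c) (hf : PT f) (hg : PT g) :
    PT (fun x => bif c x then f x else g x) :=
  (dispatch (g := fun b x => bif b then f x else g x) hc (by
    rintro (_ | _)
    exacts [hg, hf]))

protected theorem and {f g : α → Bool} (hf : PT f) (hg : PT g) : PT (fun x => f x && g x) :=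
  (PT.cond hf hg (PT.const false)).of_eq fun x => by cases f x <;> rfl

theorem all {l : α → List β} {p : α → β → Bool} (hl : PT l)
    (hp : PT (fun x : α × β => p x.1 x.2)) : PT (fun x => (l x).all (p x)) := by
  have := foldr_add (l := l) (s := fun _ => true) (h := fun x y c => p x y && c) hl (PT.const _)
    ((hp.comp (PT.fst.pair PT.snd.fst')).and PT.snd.snd') 0 (fun x c y _ => by simp)
  refine this.of_eq fun x => ?_
  induction l x with
  | nil => rfl
  | cons y m ih => simp [ih]

protected theorem not {f : α → Bool} (hf : PT f) : PT (fun x => !f x) :=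
  (PT.ofFin Bool.not).comp hf

end PT

/-- Equality is decidable in polynomial time. -/
def PTEq (α : Type) [Rep α] [DecidableEq α] : Prop := PT (fun x : α × α => decide (x.1 = x.2))

namespace PTEq

variable {α β γ : Type} [Rep α] [Rep β] [Rep γ] [DecidableEq α] [DecidableEq β]

theorem of_finRep {ι : Type} [FinRep ι] [DecidableEq ι] : PTEq ι :=
  PT.dispatch (α := ι × ι) (g := fun i x => decide (i = x.2)) PT.fst fun i =>
    (PT.ofFin fun j => decide (i = j)).comp PT.snd

theorem decide_eq (h : PTEq α) {f g : γ → α} (hf : PT f) (hg : PT g) :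
    PT (fun x => decide (f x = g x)) := PT.comp h (hf.pair hg)

theorem prod (hα : PTEq α) (hβ : PTEq β) : PTEq (α × β) :=
  ((hα.decide_eq PT.fst.fst' PT.snd.fst').and (hβ.decide_eq PT.fst.snd' PT.snd.snd')).of_eq
    fun x => by rcases x with ⟨⟨a, b⟩, c, d⟩; simp

/-- Fold over the first list with the state (equal so far, unread part of the second list). If the
second list is exhausted too early the flag becomes `false`; at the end its unread part must be
empty. -/
theorem list (hα : PTEq α) : PTEq (List α) := by
  have := PT.foldl_add (l := fun x : List α × List α => x.1) (s := fun x => (true, x.2))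
    (h := fun _ c y => match c.2 with
      | [] => (false, [])
      | z :: m => (c.1 && decide (y = z), m)) PT.fst ((PT.const true).pair PT.snd)
    (PT.listCases (f := fun _ => (false, []))
      (g := fun (x : (List α × List α) × (Bool × List α) × α) z m =>
        (x.2.1.1 && decide (x.2.2 = z), m)) PT.snd.fst'.snd' (PT.const _)
      ((PT.snd.snd'.fst'.fst'.and (hα.decide_eq PT.snd.snd'.snd' PT.fst.fst')).pair PT.fst.snd'))
    0 (fun x c y _ => by
      rcases c with ⟨c, _ | ⟨z, m⟩⟩ <;> simp; omega)
  have h2 : PT (fun x : Bool × List α => match x.2 with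
      | [] => x.1
      | _ :: _ => false) := PT.listCases (g := fun _ _ _ => false) PT.snd PT.fst (PT.const _)
  refine (h2.comp this).of_eq fun x => ?_
  have key : ∀ (l m : List α) (c : Bool),
      (fun x : Bool × List α => match x.2 with
        | [] => x.1
        | _ :: _ => false) (l.foldl (fun (c : Bool × List α) y => match c.2 with
          | [] => (false, [])
          | z :: m => (c.1 && decide (y = z), m)) (c, m)) = (c && decide (l = m)) := by
    intro l
    induction l with
    | nil => intro m c; cases m <;> simp
    | cons y l ih =>
      intro m c
      cases m with
      | nil => exact (ih [] false).trans (by simp)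
      | cons z m => exact (ih m (c && decide (y = z))).trans (by simp [Bool.and_assoc])
  exact (key x.1 x.2 true).trans (by simp)

theorem mem (hα : PTEq α) {f : γ → α} {l : γ → List α} (hf : PT f) (hl : PT l) :
    PT (fun x => decide (f x ∈ l x)) :=
  (PT.all (p := fun x y => !decide (f x = y)) hl
    (hα.decide_eq (hf.comp PT.fst) PT.snd).not).not.of_eq fun x => by
      rw [Bool.eq_iff_iff]
      simp

theorem subset (hα : PTEq α) {f g : γ → List α} (hf : PT f) (hg : PT g) :
    PT (fun x => (f x).all fun y => decide (y ∈ g x)) :=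
  PT.all (p := fun x y => decide (y ∈ g x)) hf (hα.mem PT.snd (hg.comp PT.fst))

end PTEq

/-! ### From programs on trees to Turing machines -/

/-- The stacks of the final machine: input, output, and working stacks. -/
inductive Stacks : Type
  | inp : Stacks
  | out : Stacks
  | wk (k : Wk) : Stacks
  deriving DecidableEq

instance : Finite Stacks :=
  Finite.of_surjective
    (fun o : Option (Option Wk) => match o with
      | none => Stacks.inp
      | some none => Stacks.out
      | some (some k) => Stacks.wk k)
    (by
      rintro (_ | _ | k)
      exacts [⟨none, rfl⟩, ⟨some none, rfl⟩, ⟨some (some k), rfl⟩])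

/-- The stack alphabets of the final machine. -/
abbrev Stacks.alphabet (A B : Type) : Stacks → Type
  | .inp => A
  | .out => B
  | .wk _ => Sy

/-- The contents of the stacks of the final machine. -/
def Stacks.store {A B : Type} (i : List A) (o : List B) (s : Wk → List Sy) :
    ∀ k, List (Stacks.alphabet A B k)
  | .inp => i
  | .out => o
  | .wk k => s k

section glue

variable {A B : Type} (i : List A) (o : List B) (s : Wk → List Sy)

@[simp] theorem store_update_inp (x : List A) :
    Function.update (Stacks.store i o s) .inp x = Stacks.store x o s := by
  funext k
  rcases k with _ | _ | k <;> simp [Stacks.store]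

@[simp] theorem store_update_out (x : List B) :
    Function.update (Stacks.store i o s) .out x = Stacks.store i x s := by
  funext k
  rcases k with _ | _ | k <;> simp [Stacks.store]

@[simp] theorem store_update_wk (k' : Wk) (x : List Sy) :
    Function.update (Stacks.store i o s) (.wk k') x = Stacks.store i o (Function.update s k' x) := by
  funext k
  rcases k with _ | _ | k
  · simp [Stacks.store]
  · simp [Stacks.store]
  · by_cases h : k = k'
    · subst h; simp [Stacks.store]
    · have : Stacks.wk k ≠ Stacks.wk k' := by simpa using h
      simp [Stacks.store, h]

/-- A program on the working stacks as part of the final program. -/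
def WCmd.lift (A B : Type) : WCmd → Cmd Stacks (Stacks.alphabet A B)
  | .skip => .skip
  | .push k a => .push (.wk k) a
  | .pop k => .pop (.wk k)
  | .seq c d => .seq (lift A B c) (lift A B d)
  | .case k f => .case (.wk k) fun x => lift A B (f x)
  | .while k p c => .while (.wk k) p (lift A B c)

theorem exec_lift {c : WCmd} {s s' : Wk → List Sy} {t : ℕ} (h : Exec c s s' t) :
    Exec (c.lift A B) (Stacks.store i o s) (Stacks.store i o s') t := by
  induction h with
  | skip h => exact .skip h
  | @push k a s t h =>
    have := @Exec.push Stacks (Stacks.alphabet A B) _ (.wk k) a (Stacks.store i o s) t h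
    rwa [store_update_wk] at this
  | @pop k s t h =>
    have := @Exec.pop Stacks (Stacks.alphabet A B) _ (.wk k) (Stacks.store i o s) t h
    rwa [store_update_wk] at this
  | seq _ _ h ih₁ ih₂ => exact .seq ih₁ ih₂ h
  | case _ h ih => exact .case ih h
  | while_true hp _ _ h ih₁ ih₂ => exact .while_true hp ih₁ ih₂ h
  | while_false hp h => exact .while_false hp h

variable [FinRep A] [FinRep B]

/-- Move the input to the working stacks, as a list in reverse order. -/
def readInput (A B : Type) [FinRep A] : Cmd Stacks (Stacks.alphabet A B) :=
  .while .inp (fun x => x.isSome)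
    (.case .inp fun x => match x with
      | some a => .seq (.pop .inp)
        (WCmd.lift A B (pushAll [Sy.node, Sy.leaf (FinRep.code a)]))
      | none => .skip)

omit [FinRep B] in
theorem exec_readInput (o : List B) : ∀ (w v : List A),
    Exec (readInput A B) (Stacks.store w o (St (Rep.toTree v).enc [] [] []))
      (Stacks.store [] o (St (Rep.toTree (w.reverse ++ v)).enc [] [] [])) (6 * w.length + 1)
  | [], v => .while_false rfl (by simp)
  | a :: w, v => by
    have h2 := exec_readInput o w (a :: v)
    have e : w.reverse ++ a :: v = (a :: w).reverse ++ v := by simp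
    rw [e] at h2
    refine .while_true (t₁ := 5) rfl (.case (t₁ := 4) ?_ le_rfl) h2 (by simp; omega)
    have h0 := @Exec.pop Stacks (Stacks.alphabet A B) _ .inp
      (Stacks.store (a :: w) o (St (Rep.toTree v).enc [] [] [])) 1 le_rfl
    rw [store_update_inp] at h0
    exact .seq (t₂ := 3) h0 (exec_lift _ _ (exec_pushAll _ _ _ _ [_, _])) le_rfl

/-- Move a list of symbols from the working stacks to the output, reversing it. -/
def writeOutput (A B : Type) [FinRep B] : Cmd Stacks (Stacks.alphabet A B) :=
  .seq (.while (.wk .data) (fun x => x == some Sy.node)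
    (.seq (.pop (.wk .data)) (.case (.wk .data) fun x => match x with
      | some (Sy.leaf a) => .seq (.pop (.wk .data)) (.push .out (FinRep.decode a : B))
      | _ => .skip))) (.pop (.wk .data))

omit [FinRep A] in
theorem exec_writeOutput (v w : List B) :
    Exec (writeOutput A B) (Stacks.store [] v (St (Rep.toTree w).enc [] [] []))
      (Stacks.store [] (w.reverse ++ v) (St [] [] [] [])) (5 * w.length + 2) := by
  have hpop : ∀ (i : List A) (o : List B) (x : Sy) (a : List Sy), Exec (.pop (.wk .data))
      (Stacks.store i o (St (x :: a) [] [] [])) (Stacks.store i o (St a [] [] [])) 1 := by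
    intro i o x a
    have h0 := @Exec.pop Stacks (Stacks.alphabet A B) _ (.wk .data)
      (Stacks.store i o (St (x :: a) [] [] [])) 1 le_rfl
    rw [store_update_wk] at h0
    exact (St.update_data (x :: a) [] [] [] a) ▸ h0
  refine .seq (t₁ := 5 * w.length + 1) (t₂ := 1)
    (s₂ := Stacks.store [] (w.reverse ++ v) (St [Sy.leaf 0] [] [] [])) ?_ (hpop _ _ _ _) (by omega)
  induction w generalizing v with
  | nil => exact .while_false rfl (by simp)
  | cons a w ih =>
    have h2 := ih (a :: v)
    have e : w.reverse ++ a :: v = (a :: w).reverse ++ v := by simp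
    rw [e] at h2
    refine .while_true (t₁ := 4) rfl ?_ h2 (by simp; omega)
    refine .seq (t₁ := 1) (t₂ := 3) (hpop _ _ _ _) (.case (t₁ := 2) ?_ le_rfl) le_rfl
    refine .seq (t₁ := 1) (t₂ := 1) (hpop _ _ _ _) ?_ le_rfl
    have h0 := @Exec.push Stacks (Stacks.alphabet A B) _ .out (FinRep.decode (FinRep.code a))
      (Stacks.store [] v (St (Rep.toTree w).enc [] [] [])) 1 le_rfl
    rw [store_update_out, FinRep.decode_code] at h0
    simp only [FinRep.decode_code]
    exact h0

omit [FinRep A] [FinRep B] in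
theorem single_inp (w : List A) :
    Cmd.single (Γ := Stacks.alphabet A B) .inp w = Stacks.store w [] (St [] [] [] []) := by
  funext k
  rcases k with _ | _ | _ | _ | _ | _ <;> simp [Cmd.single, Stacks.store, St]

omit [FinRep A] [FinRep B] in
theorem single_out (w : List B) :
    Cmd.single (Γ := Stacks.alphabet A B) .out w = Stacks.store [] w (St [] [] [] []) := by
  funext k
  rcases k with _ | _ | _ | _ | _ | _ <;> simp [Cmd.single, Stacks.store, St]

theorem finite_of_finRep (A : Type) [FinRep A] : Finite A :=
  Finite.of_surjective (FinRep.decode : Fin 16 → A) fun a => ⟨_, FinRep.decode_code a⟩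

omit [FinRep B] in
theorem sz_list_finRep (w : List A) : sz w = 2 * w.length + 1 := by
  induction w with
  | nil => simp
  | cons a w ih => simp [ih]; omega

/-- A string function that is computed in polynomial time by a program on trees gives a
polynomial-time Turing machine. -/
theorem PT.nonempty_tm2 {F : List A → List B} (hF : PT F) {α β : Type} (ea : α → List A)
    (eb : β → List B) (f : α → β) (h : ∀ a, eb (f a) = F (ea a)) :
    Nonempty (TM2ComputableInPolyTime ea eb f) := by
  -- Reading the input and writing the output each reverse a list, so `F` is conjugated by reversal.
  -- In the bound below, `2 * X + 1` is the size of the tree of a word of length `X`.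
  obtain ⟨c, p, hc⟩ := PT.reverse.comp (hF.comp PT.reverse)
  have := finite_of_finRep A
  have := finite_of_finRep B
  have : ∀ k, Finite (Stacks.alphabet A B k) := by
    rintro (_ | _ | k) <;> infer_instance
  have := Fintype.ofFinite Stacks
  refine Cmd.nonempty_tm2ComputableInPolyTime (Γ := Stacks.alphabet A B) .inp .out
    (.seq (WCmd.lift A B (.push .data (Sy.leaf 0))) (.seq (readInput A B)
      (.seq (WCmd.lift A B c) (writeOutput A B)))) ea eb f
    (1 + (6 * Polynomial.X + 1 + (p.comp (2 * Polynomial.X + 1) +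
      (5 * p.comp (2 * Polynomial.X + 1) + 2)))) fun a => ?_
  rw [single_inp, single_out]
  have h1 := exec_lift (A := A) (B := B) (ea a) [] (push_data (x := Sy.leaf 0) (a := []) (b := [])
    (c := []) (d := []))
  have h2 := exec_readInput (A := A) (B := B) [] (ea a) []
  have h3 := exec_lift (A := A) (B := B) [] [] ((hc (ea a).reverse).1 [] [] [] [])
  have h4 := exec_writeOutput (A := A) [] (F (ea a)).reverse
  have hs := (hc (ea a).reverse).2
  simp only [List.reverse_reverse, List.append_nil] at h2 h3 h4 hs
  rw [h]
  refine .seq h1 (.seq h2 (.seq h3 h4 le_rfl) le_rfl) ?_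
  have h5 := length_lt_sz (F (ea a)).reverse
  rw [sz_list_finRep (ea a).reverse, List.length_reverse] at hs ⊢
  simp only [Polynomial.eval_add, Polynomial.eval_mul, Polynomial.eval_X, Polynomial.eval_ofNat,
    Polynomial.eval_comp, Polynomial.eval_one]
  rw [List.length_reverse] at h5 ⊢
  omega

end glue
end TermEquivalence

namespace TermEquivalence

open Turing

/-! ### Systems of equations between vertices -/

section unify

variable {V : Type} [DecidableEq V]

/-- Substitute `a` for `b`. -/
def subst (a b x : V) : V := bif decide (x = b) then a else x

/-- Substitute `a` for `b` in a list of pairs. -/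
def substPairs (a b : V) (l : List (V × V)) : List (V × V) :=
  l.map fun e => (subst a b e.1, subst a b e.2)

/-- Solve the first equation of the first list. -/
def unifyStep (x : List (V × V) × List (V × V)) : List (V × V) × List (V × V) :=
  match x.1 with
  | [] => x
  | e :: l => (substPairs e.1 e.2 l, substPairs e.1 e.2 x.2)

/-- Do the equations `E` imply the equations `T`? -/
def unify (E T : List (V × V)) : Bool :=
  (unifyStep^[E.length] (E, T)).2.all fun e => decide (e.1 = e.2)

/-- The assignment `f` satisfies the equations `E`. -/
def Solves {β : Type*} (f : V → β) (E : List (V × V)) : Prop := ∀ e ∈ E, f e.1 = f e.2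

theorem solves_substPairs {β : Type*} (f : V → β) (a b : V) (E : List (V × V)) :
    Solves f (substPairs a b E) ↔ Solves (fun x => f (subst a b x)) E := by
  simp only [Solves, substPairs, List.forall_mem_map]

/-- Substituting `a` for `b` identifies the solutions of `a = b` with functions composed with the
substitution. This removes one equation at a time; with none left, the equations `T` follow only if
they are trivial, because `β` has two values with which to separate distinct vertices. In particular
the answer does not depend on `β`. -/
theorem unify_iff {β : Type*} [Nontrivial β] (E T : List (V × V)) :
    unify E T = true ↔ ∀ f : V → β, Solves f E → Solves f T := by
  unfold unify
  generalize hn : E.length = n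
  induction n generalizing E T with
  | zero =>
    obtain rfl := List.length_eq_zero_iff.1 hn
    simp only [Function.iterate_zero, id, List.all_eq_true, decide_eq_true_eq]
    constructor
    · intro h f _ e he
      rw [h e he]
    · intro h e he
      by_contra hne
      obtain ⟨x, y, hxy⟩ := exists_pair_ne β
      -- The indicator of `e.1` violates a nontrivial equation.
      have := h (fun v => if v = e.1 then x else y) (by simp [Solves]) e he
      simp [Ne.symm hne, hxy] at this
  | succ n ih =>
    obtain _ | ⟨⟨a, b⟩, E⟩ := E
    · simp at hn
    have h1 : unifyStep ((a, b) :: E, T) = (substPairs a b E, substPairs a b T) := rfl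
    have h2 : (substPairs a b E).length = n := by simpa [substPairs] using hn
    rw [Function.iterate_succ_apply, h1, ih _ _ h2]
    constructor
    · intro h f hf
      have hab : f a = f b := hf (a, b) List.mem_cons_self
      have hs : (fun x => f (subst a b x)) = f := by
        funext x
        by_cases hx : x = b <;> simp [subst, hx, hab]
      have := h f
      rw [solves_substPairs, solves_substPairs, hs] at this
      exact this fun e he => hf e (List.mem_cons_of_mem _ he)
    · intro h f hf
      rw [solves_substPairs] at hf ⊢
      refine h _ fun e he => ?_
      rcases List.mem_cons.1 he with rfl | he
      · by_cases hx : a = b <;> simp [subst, hx]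
      · exact hf e he

end unify

/-! ### Adjacencies in words -/

section words

variable {α : Type} [DecidableEq α]

/-- One step of collecting the adjacencies in a word, from right to left. -/
def edgeStep (x : α) (s : List (Bool × α) × List ((Bool × α) × (Bool × α))) :
    List (Bool × α) × List ((Bool × α) × (Bool × α)) :=
  ([(true, x)], match s.1 with
    | [] => s.2
    | r :: _ => ((false, x), r) :: s.2)

/-- The pairs of adjacent letters `x`, `y` in a word, as pairs `((false, x), (true, y))`. -/
def edges (w : List α) : List ((Bool × α) × (Bool × α)) := (w.foldr edgeStep ([], [])).2

omit [DecidableEq α] in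
theorem edges_cons_cons (x y : α) (w : List α) :
    edges (x :: y :: w) = ((false, x), (true, y)) :: edges (y :: w) := rfl

omit [DecidableEq α] in
theorem edges_fst_snd : ∀ (w : List α), ∀ e ∈ edges w, e.1.1 = false ∧ e.2.1 = true
  | [], e, he => by simp [edges] at he
  | [x], e, he => by simp [edges, edgeStep] at he
  | x :: y :: w, e, he => by
    rw [edges_cons_cons, List.mem_cons] at he
    rcases he with rfl | he
    · simp
    · exact edges_fst_snd (y :: w) e he

omit [DecidableEq α] in
theorem isChain_iff_edges {r : α → α → Prop} : ∀ w : List α,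
    w.IsChain r ↔ ∀ e ∈ edges w, r e.1.2 e.2.2
  | [] => by simp [edges]
  | [x] => by simp [edges, edgeStep]
  | x :: y :: w => by
    rw [edges_cons_cons, List.isChain_cons_cons, isChain_iff_edges (y :: w)]
    simp

/-- The last letter of a word. -/
def lastLetter (w : List α) (d : α) : α := w.reverse.headD d

omit [DecidableEq α] in
theorem lastLetter_cons_cons (x y : α) (w : List α) (d : α) :
    lastLetter (x :: y :: w) d = lastLetter (y :: w) d := by
  simp only [lastLetter, List.reverse_cons]
  cases w.reverse <;> simp

/-- The test on the words `p` and `q` that is equivalent to their equality as functions on a Rees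
matrix semigroup over the trivial group, apart from an answer `false` in some cases of empty words.
The parameters describe the matrix: whether the nonzero entries form disjoint blocks, whether there
is only one block, and whether each row or column has only one nonzero entry. -/
def wordTest (rect one rows cols : Bool) (d : α) (p q : List α) : Bool :=
  ((p.all fun x => decide (x ∈ q)) && (q.all fun x => decide (x ∈ p))) &&
  ((bif rows then true else decide (p.headD d = q.headD d)) &&
  ((bif cols then true else decide (lastLetter p d = lastLetter q d)) &&
  (bif rect then
    bif one then true else
      (unify (edges p) (edges q ++
          ((bif rows then [((true, p.headD d), (true, q.headD d))] else []) ++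
          (bif cols then [((false, lastLetter p d), (false, lastLetter q d))] else []))) &&
        unify (edges q) (edges p))
  else ((edges p).all fun e => decide (e ∈ edges q)) &&
    ((edges q).all fun e => decide (e ∈ edges p)))))

end words

/-! ### Comparing words on the zero pattern of the matrix. -/

section relation

variable {α : Type} [DecidableEq α] {I Λ : Type*} {R : Λ → I → Prop}

/-- The words `p` and `q` induce the same function on the Rees matrix semigroup over the trivial
group with nonzero entries given by `R`, as far as values `≠ 0` of the variables are concerned. -/
def SameHoms (R : Λ → I → Prop) (d : α) (p q : List α) : Prop :=
  ∀ (i : α → I) (l : α → Λ),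
    (p.IsChain (fun x y => R (l x) (i y)) ↔ q.IsChain (fun x y => R (l x) (i y))) ∧
    (p.IsChain (fun x y => R (l x) (i y)) →
      i (p.headD d) = i (q.headD d) ∧ l (lastLetter p d) = l (lastLetter q d))

omit [DecidableEq α] in
theorem isChain_of_forall {r : α → α → Prop} (h : ∀ x y, r x y) (w : List α) : w.IsChain r :=
  (isChain_iff_edges w).2 fun _ _ => h _ _

/-- If a row `l` has nonzero entries in two columns, give all letters the row `l`, and one of these
columns to the first letter of `p` and the other to all other letters. No product vanishes, and the
column of the value reveals the first letter. -/
theorem SameHoms.head_eq {d : α} {p q : List α} (h : SameHoms R d p q)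
    (hR : ¬ ∀ l i i', R l i → R l i' → i = i') : p.headD d = q.headD d := by
  push Not at hR
  obtain ⟨l, i, i', h1, h2, h3⟩ := hR
  by_contra hne
  have := ((h (fun x => if x = p.headD d then i else i') fun _ => l).2
    (isChain_of_forall (fun x y => by split_ifs <;> assumption) _)).1
  rw [if_pos rfl, if_neg (Ne.symm hne)] at this
  exact h3 this

theorem SameHoms.last_eq {d : α} {p q : List α} (h : SameHoms R d p q)
    (hR : ¬ ∀ l l' i, R l i → R l' i → l = l') : lastLetter p d = lastLetter q d := by
  push Not at hR
  obtain ⟨l, l', i, h1, h2, h3⟩ := hR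
  by_contra hne
  have := ((h (fun _ => i) fun x => if x = lastLetter p d then l else l').2
    (isChain_of_forall (fun x y => by split_ifs <;> assumption) _)).2
  rw [if_pos rfl, if_neg (Ne.symm hne)] at this
  exact h3 this

/-- Suppose that the adjacency `x y` occurs in `p` but not in `q`. Give `x` the row `l` and all
others `l'`; give `y` the column `i'` and all others `i`. The only zero entry that can be met is at
`(l, i')`, and it is met exactly at the adjacency `x y`. So `q` survives and `p` vanishes. -/
theorem edges_subset_of_isChain {l l' : Λ} {i i' : I} (h₁ : R l i) (h₂ : R l' i) (h₃ : R l' i')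
    (h₄ : ¬ R l i') {p q : List α}
    (h : ∀ (i : α → I) (l : α → Λ), q.IsChain (fun x y => R (l x) (i y)) →
      p.IsChain (fun x y => R (l x) (i y))) : ∀ e ∈ edges p, e ∈ edges q := by
  intro e he
  by_contra hne
  have := h (fun x => if x = e.2.2 then i' else i) (fun x => if x = e.1.2 then l else l')
    ((isChain_iff_edges q).2 fun e' he' => ?_)
  · have := (isChain_iff_edges p).1 this e he
    simp [h₄] at this
  · split_ifs with ha hb hb
    · exfalso
      obtain ⟨h5, h6⟩ := edges_fst_snd p e he
      obtain ⟨h7, h8⟩ := edges_fst_snd q e' he'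
      have : e' = e := Prod.ext (Prod.ext (h7.trans h5.symm) ha) (Prod.ext (h8.trans h6.symm) hb)
      exact hne (this ▸ he')
    all_goals assumption

/-- The square with one zero also contains a row and a column with two nonzero entries each, so the
first and last letters are determined as well. -/
theorem sameHoms_iff_of_not_rect (hR : ¬ ∀ l l' i i', R l i → R l' i → R l' i' → R l i')
    (d : α) (p q : List α) : SameHoms R d p q ↔
      p.headD d = q.headD d ∧ lastLetter p d = lastLetter q d ∧
        (∀ e ∈ edges p, e ∈ edges q) ∧ ∀ e ∈ edges q, e ∈ edges p := by
  push Not at hR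
  obtain ⟨l, l', i, i', h₁, h₂, h₃, h₄⟩ := hR
  constructor
  · intro h
    refine ⟨h.head_eq fun H => ?_, h.last_eq fun H => ?_,
      edges_subset_of_isChain h₁ h₂ h₃ h₄ fun i l => (h i l).1.2,
      edges_subset_of_isChain h₁ h₂ h₃ h₄ fun i l => (h i l).1.1⟩
    · exact h₄ (H _ _ _ h₂ h₃ ▸ h₁)
    · exact h₄ (H _ _ _ h₁ h₂ ▸ h₃)
  · rintro ⟨h1, h2, h3, h4⟩ i l
    refine ⟨?_, fun _ => ⟨by rw [h1], by rw [h2]⟩⟩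
    rw [isChain_iff_edges, isChain_iff_edges]
    exact ⟨fun h e he => h e (h4 e he), fun h e he => h e (h3 e he)⟩

/-- The label of a row is its set of nonzero columns; the label of a column is the set of columns
that share a nonzero row with it. Regularity excludes labels not shared by a row and a column. -/
theorem exists_blocks (hreg : (∀ l, ∃ i, R l i) ∧ ∀ i, ∃ l, R l i)
    (hR : ∀ l l' i i', R l i → R l' i → R l' i' → R l i') :
    ∃ (cl : Λ → Set I) (ci : I → Set I), Set.range cl = Set.range ci ∧
      ∀ l i, R l i ↔ cl l = ci i := by
  have key : ∀ l i, R l i ↔ {i' | R l i'} = {i' | ∃ l', R l' i ∧ R l' i'} := by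
    intro l i
    constructor
    · intro h
      ext i'
      exact ⟨fun h' => ⟨l, h, h'⟩, fun ⟨l', h1, h2⟩ => hR _ _ _ _ h h1 h2⟩
    · intro h
      obtain ⟨l', h'⟩ := hreg.2 i
      exact (Set.ext_iff.1 h i).2 ⟨l', h', h'⟩
  refine ⟨fun l => {i' | R l i'}, fun i => {i' | ∃ l', R l' i ∧ R l' i'}, ?_, key⟩
  ext s
  constructor
  · rintro ⟨l, rfl⟩
    obtain ⟨i, hi⟩ := hreg.1 l
    exact ⟨i, ((key l i).1 hi).symm⟩
  · rintro ⟨i, rfl⟩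
    obtain ⟨l, hl⟩ := hreg.2 i
    exact ⟨l, (key l i).1 hl⟩

/-- Vanishing depends only on the labels: `f (false, x)` is that of the row of `x` and `f (true, x)`
that of its column. A word survives if and only if `f` solves its adjacencies, and every `f` occurs
by surjectivity. If each row has only one nonzero column, a column is determined by its label, so
equal labels at the first letters suffice; otherwise the first letters must coincide. The last
letters behave dually. -/
theorem sameHoms_iff_of_blocks {β : Type*} {cl : Λ → β} {ci : I → β}
    (hcl : Function.Surjective cl) (hci : Function.Surjective ci)
    (hR : ∀ l i, R l i ↔ cl l = ci i) (d : α) (p q : List α) : SameHoms R d p q ↔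
      ((¬ ∀ l i i', R l i → R l i' → i = i') → p.headD d = q.headD d) ∧
      ((¬ ∀ l l' i, R l i → R l' i → l = l') → lastLetter p d = lastLetter q d) ∧
      (∀ f : Bool × α → β, Solves f (edges p) → Solves f (edges q)) ∧
      (∀ f : Bool × α → β, Solves f (edges q) → Solves f (edges p)) ∧
      ((∀ l i i', R l i → R l i' → i = i') → ∀ f : Bool × α → β, Solves f (edges p) →
        f (true, p.headD d) = f (true, q.headD d)) ∧
      ((∀ l l' i, R l i → R l' i → l = l') → ∀ f : Bool × α → β, Solves f (edges p) →
        f (false, lastLetter p d) = f (false, lastLetter q d)) := by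
  have chain : ∀ (w : List α) (f : Bool × α → β) (i : α → I) (l : α → Λ),
      (∀ x, cl (l x) = f (false, x)) → (∀ x, ci (i x) = f (true, x)) →
      (w.IsChain (fun x y => R (l x) (i y)) ↔ Solves f (edges w)) := by
    intro w f i l h1 h2
    rw [isChain_iff_edges]
    refine forall₂_congr fun e he => ?_
    obtain ⟨⟨a, x⟩, ⟨b, y⟩⟩ := e
    obtain ⟨h3, h4⟩ := edges_fst_snd w _ he
    simp only at h3 h4
    subst h3 h4
    rw [hR, h1, h2]
  have lift : ∀ f : Bool × α → β, ∃ (i : α → I) (l : α → Λ),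
      (∀ x, cl (l x) = f (false, x)) ∧ ∀ x, ci (i x) = f (true, x) := fun f => by
    choose sl hsl using hcl
    choose si hsi using hci
    exact ⟨fun x => si (f (true, x)), fun x => sl (f (false, x)), fun x => hsl _, fun x => hsi _⟩
  constructor
  · intro h
    refine ⟨h.head_eq, h.last_eq, fun f => ?_, fun f => ?_, fun _ f hf => ?_, fun _ f hf => ?_⟩ <;>
      obtain ⟨i, l, h1, h2⟩ := lift f
    · rw [← chain p f i l h1 h2, ← chain q f i l h1 h2]
      exact (h i l).1.1
    · rw [← chain p f i l h1 h2, ← chain q f i l h1 h2]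
      exact (h i l).1.2
    · rw [← chain p f i l h1 h2] at hf
      rw [← h2, ← h2, ((h i l).2 hf).1]
    · rw [← chain p f i l h1 h2] at hf
      rw [← h1, ← h1, ((h i l).2 hf).2]
  · rintro ⟨h1, h2, h3, h4, h5, h6⟩ i l
    have hf : ∃ f : Bool × α → β, (∀ x, cl (l x) = f (false, x)) ∧ ∀ x, ci (i x) = f (true, x) :=
      ⟨fun v => bif v.1 then ci (i v.2) else cl (l v.2), fun _ => rfl, fun _ => rfl⟩
    obtain ⟨f, g1, g2⟩ := hf
    rw [chain p f i l g1 g2, chain q f i l g1 g2]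
    refine ⟨⟨h3 f, h4 f⟩, fun hf => ⟨?_, ?_⟩⟩
    · by_cases hr : ∀ l i i', R l i → R l i' → i = i'
      · have := h5 hr f hf
        rw [← g2, ← g2] at this
        obtain ⟨l', hl'⟩ := hcl (ci (i (p.headD d)))
        exact hr l' _ _ ((hR _ _).2 hl') ((hR _ _).2 (hl'.trans this))
      · rw [h1 hr]
    · by_cases hr : ∀ l l' i, R l i → R l' i → l = l'
      · have := h6 hr f hf
        rw [← g1, ← g1] at this
        obtain ⟨i', hi'⟩ := hci (cl (l (lastLetter p d)))
        exact hr _ _ i' ((hR _ _).2 hi'.symm) ((hR _ _).2 (hi'.trans this).symm)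
      · rw [h2 hr]

/-- For every regular matrix, one of the tests decides whether two words with the same variables
induce the same function. -/
theorem exists_wordTest (hreg : (∀ l, ∃ i, R l i) ∧ ∀ i, ∃ l, R l i) :
    ∃ rect one rows cols : Bool, ∀ (α : Type) [DecidableEq α] (d : α) (p q : List α),
      wordTest rect one rows cols d p q = true ↔ (∀ x, x ∈ p ↔ x ∈ q) ∧ SameHoms R d p q := by
  classical
  by_cases hrect : ∀ l l' i i', R l i → R l' i → R l' i' → R l i'
  · obtain ⟨cl, ci, hrange, hR⟩ := exists_blocks hreg hrect
    let β := Set.range cl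
    have e : ∀ i, ci i ∈ Set.range cl := fun i => hrange ▸ Set.mem_range_self i
    let cl' : Λ → β := fun l => ⟨cl l, Set.mem_range_self l⟩
    let ci' : I → β := fun i => ⟨ci i, e i⟩
    have hcl : Function.Surjective cl' := by
      rintro ⟨_, l, rfl⟩
      exact ⟨l, rfl⟩
    have hci : Function.Surjective ci' := by
      rintro ⟨s, hs⟩
      have hs' : s ∈ Set.range ci := hrange ▸ hs
      obtain ⟨i, rfl⟩ := hs'
      exact ⟨i, rfl⟩
    have hR' : ∀ l i, R l i ↔ cl' l = ci' i := fun l i => by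
      rw [hR, Subtype.ext_iff]
    obtain ⟨one, hone⟩ : ∃ b : Bool, b = true ↔ Subsingleton β :=
      ⟨decide (Subsingleton β), decide_eq_true_iff⟩
    obtain ⟨rows, hrows⟩ : ∃ b : Bool, b = true ↔ ∀ l i i', R l i → R l i' → i = i' :=
      ⟨decide (∀ l i i', R l i → R l i' → i = i'), decide_eq_true_iff⟩
    obtain ⟨cols, hcols⟩ : ∃ b : Bool, b = true ↔ ∀ l l' i, R l i → R l' i → l = l' :=
      ⟨decide (∀ l l' i, R l i → R l' i → l = l'), decide_eq_true_iff⟩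
    refine ⟨true, one, rows, cols, fun α _ d p q => ?_⟩
    rw [sameHoms_iff_of_blocks hcl hci hR', ← hrows, ← hcols]
    have hcontent : ((p.all fun x => decide (x ∈ q)) && (q.all fun x => decide (x ∈ p))) = true ↔
        ∀ x, x ∈ p ↔ x ∈ q := by
      simp only [Bool.and_eq_true, List.all_eq_true, decide_eq_true_eq]
      exact ⟨fun h x => ⟨h.1 x, h.2 x⟩, fun h => ⟨fun x => (h x).1, fun x => (h x).2⟩⟩
    unfold wordTest
    rw [Bool.and_eq_true, hcontent]
    refine and_congr_right fun _ => ?_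
    rw [Bool.and_eq_true, Bool.and_eq_true]
    refine and_congr ?_ (and_congr ?_ ?_)
    · cases rows <;> simp
    · cases cols <;> simp
    -- A single block makes all equations hold; `unify_iff` needs two labels, so this case is
    -- separate.
    · cases one with
      | true =>
        have := hone.1 rfl
        have hs : ∀ (f : Bool × α → β) E, Solves f E := fun f E e _ => Subsingleton.elim _ _
        simp only [cond_true, hs, true_iff]
        exact ⟨fun _ _ => trivial, fun _ _ => trivial, fun _ _ _ => Subsingleton.elim _ _,
          fun _ _ _ => Subsingleton.elim _ _⟩
      | false =>
        have : Nontrivial β := not_subsingleton_iff_nontrivial.1 fun h => by simpa using hone.2 h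
        have happ : ∀ (f : Bool × α → β) E F, Solves f (E ++ F) ↔ Solves f E ∧ Solves f F :=
          fun f E F => by simp only [Solves, List.mem_append, or_imp, forall_and]
        have hnil : ∀ (f : Bool × α → β), Solves f [] := fun f => by simp [Solves]
        have hpair : ∀ (f : Bool × α → β) u v, Solves f [(u, v)] ↔ f u = f v := fun f u v => by
          simp [Solves]
        simp only [cond_true, cond_false, Bool.and_eq_true, unify_iff (β := β), happ]
        cases rows <;> cases cols <;>
          simp only [cond_true, cond_false, hpair, hnil] <;> grind
  · refine ⟨false, false, false, false, fun α _ d p q => ?_⟩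
    rw [sameHoms_iff_of_not_rect hrect]
    simp only [wordTest, cond_false, Bool.and_eq_true, List.all_eq_true, decide_eq_true_eq]
    refine and_congr_left fun _ => ?_
    exact ⟨fun h x => ⟨h.1 x, h.2 x⟩, fun h => ⟨fun x => (h x).1, fun x => (h x).2⟩⟩

end relation
end TermEquivalence

namespace TermEquivalence

open Turing

/-! ### Words over a Rees matrix semigroup -/

/-- The value of a word. -/
def wordValue {α S : Type*} [Semigroup S] (e : α → S) (w : List α) : WithOne S :=
  (w.map fun x => (e x : WithOne S)).prod

section wordValue

variable {α S : Type*} [Semigroup S] (e : α → S)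

theorem wordValue_append (v w : List α) : wordValue e (v ++ w) = wordValue e v * wordValue e w := by
  simp [wordValue]

theorem wordValue_map {β : Type*} (f : β → α) (w : List β) :
    wordValue e (w.map f) = wordValue (fun x => e (f x)) w := by
  simp [wordValue, Function.comp_def]

theorem wordValue_singleton (x : α) : wordValue e [x] = (e x : WithOne S) := by
  simp [wordValue]

theorem wordValue_congr {e e' : α → S} {w : List α} (h : ∀ x ∈ w, e x = e' x) :
    wordValue e w = wordValue e' w := by
  unfold wordValue
  congr 1
  exact List.map_congr_left fun x hx => by rw [h x hx]

end wordValue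

namespace ReesMatrixSemigroup

variable {G I Λ : Type*} [Group G] {M : Matrix Λ I (WithZero G)}

theorem zero_mul (s : ReesMatrixSemigroup M) : zero * s = (zero : ReesMatrixSemigroup M) := by
  cases s <;> rfl

theorem mul_zero (s : ReesMatrixSemigroup M) : s * zero = (zero : ReesMatrixSemigroup M) := by
  cases s <;> rfl

theorem triple_mul_eq_zero {i j : I} {g h : G} {l k : Λ} (hM : M l j = 0) :
    (triple i g l * triple j h k : ReesMatrixSemigroup M) = zero := by
  change mul _ _ = _
  simp only [mul, hM]

theorem triple_mul {i j : I} {g h : G} {l k : Λ} {a : G} (hM : M l j = (a : WithZero G)) :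
    (triple i g l * triple j h k : ReesMatrixSemigroup M) = triple i (g * a * h) k := by
  change mul _ _ = _
  simp only [mul, hM]

theorem coe_zero_mul (a : WithOne (ReesMatrixSemigroup M)) :
    ((zero : ReesMatrixSemigroup M) : WithOne (ReesMatrixSemigroup M)) * a =
      (zero : ReesMatrixSemigroup M) := by
  cases a with
  | one => rw [mul_one]
  | coe s => rw [← WithOne.coe_mul, zero_mul]

theorem mul_coe_zero (a : WithOne (ReesMatrixSemigroup M)) :
    a * ((zero : ReesMatrixSemigroup M) : WithOne (ReesMatrixSemigroup M)) =
      (zero : ReesMatrixSemigroup M) := by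
  cases a with
  | one => rw [one_mul]
  | coe s => rw [← WithOne.coe_mul, mul_zero]

theorem prod_eq_zero {L : List (WithOne (ReesMatrixSemigroup M))}
    (h : ((zero : ReesMatrixSemigroup M) : WithOne (ReesMatrixSemigroup M)) ∈ L) :
    L.prod = (zero : ReesMatrixSemigroup M) := by
  obtain ⟨u, v, rfl⟩ := List.append_of_mem h
  rw [List.prod_append, List.prod_cons, coe_zero_mul, mul_coe_zero]

theorem wordValue_eq_zero {α : Type*} {e : α → ReesMatrixSemigroup M} {w : List α} {x : α}
    (hx : x ∈ w) (h : e x = zero) : wordValue e w = (zero : ReesMatrixSemigroup M) :=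
  prod_eq_zero (List.mem_map.2 ⟨x, hx, by rw [h]⟩)

-- Every entry that contributes is `1`, so the group component is the product of the group values
-- and does not depend on the rows and columns. This is where the 0-1 hypothesis enters.
open Classical in
theorem wordValue_triple (hM : IsZeroOneMatrix M) {α : Type} [DecidableEq α] (d : α)
    (i : α → I) (g : α → G) (l : α → Λ) : ∀ w : List α, w ≠ [] →
    wordValue (fun x => (triple (i x) (g x) (l x) : ReesMatrixSemigroup M)) w =
      if w.IsChain (fun x y => M (l x) (i y) ≠ 0) then
        ((triple (i (w.headD d)) (w.map g).prod (l (lastLetter w d)) : ReesMatrixSemigroup M) :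
          WithOne (ReesMatrixSemigroup M))
      else (zero : ReesMatrixSemigroup M)
  | [], h => (h rfl).elim
  | [x], _ => by simp [wordValue, lastLetter]
  | x :: y :: w, _ => by
    have ih := wordValue_triple hM d i g l (y :: w) (by simp)
    have e : wordValue (fun x => (triple (i x) (g x) (l x) : ReesMatrixSemigroup M)) (x :: y :: w) =
        ((triple (i x) (g x) (l x) : ReesMatrixSemigroup M) : WithOne (ReesMatrixSemigroup M)) *
        wordValue (fun x => (triple (i x) (g x) (l x) : ReesMatrixSemigroup M)) (y :: w) := by
      simp [wordValue]
    rw [e, ih, lastLetter_cons_cons]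
    by_cases h1 : (y :: w).IsChain fun x y => M (l x) (i y) ≠ 0
    · rcases hM (l x) (i y) with h2 | h2
      · rw [if_pos h1, if_neg (by simp [List.isChain_cons_cons, h2]), ← WithOne.coe_mul]
        rw [List.headD_cons, triple_mul_eq_zero h2]
      · rw [if_pos h1, if_pos (List.isChain_cons_cons.2 ⟨by simp [h2], h1⟩), ← WithOne.coe_mul]
        rw [List.headD_cons, triple_mul (a := 1) (by simpa using h2)]
        simp
    · rw [if_neg h1, if_neg (fun h => h1 (List.isChain_cons_cons.1 h).2), mul_coe_zero]

/-- Three kinds of assignments isolate the conditions: `0` at one variable detects the letters;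
group component `1` throughout detects the zero pattern; a fixed row and column with nonzero entry
detect the group words. Conversely, equal sets of letters reduce the claim to triples, where
`wordValue_triple` gives both values. -/
theorem forall_wordValue_iff (hreg : IsRegularMatrix M) [Nonempty I] (hM : IsZeroOneMatrix M)
    {α : Type} [DecidableEq α] (d : α) {p q : List α} (hp : p ≠ []) (hq : q ≠ []) :
    (∀ e : α → ReesMatrixSemigroup M, wordValue e p = wordValue e q) ↔
      ((∀ x, x ∈ p ↔ x ∈ q) ∧ SameHoms (fun l i => M l i ≠ 0) d p q) ∧
        ∀ g : α → G, (p.map g).prod = (q.map g).prod := by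
  classical
  obtain ⟨i₀⟩ := ‹Nonempty I›
  obtain ⟨l₀, hl₀⟩ := hreg.2 i₀
  have hall : ∀ w : List α, w.IsChain fun _ _ => M l₀ i₀ ≠ 0 :=
    isChain_of_forall fun _ _ => hl₀
  constructor
  · intro h
    have content : ∀ {p q : List α}, p ≠ [] → (∀ e : α → ReesMatrixSemigroup M,
        wordValue e p = wordValue e q) → ∀ x, x ∈ q → x ∈ p := by
      intro p q hp h x hx
      by_contra hxp
      have h1 := h fun y => if y = x then zero else triple i₀ 1 l₀
      rw [wordValue_eq_zero hx (by simp), wordValue_congr (e' := fun _ => triple i₀ 1 l₀)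
        (fun y hy => if_neg (fun hyx : y = x => hxp (hyx ▸ hy))),
        wordValue_triple hM d (fun _ => i₀) (fun _ => 1) (fun _ => l₀) p hp, if_pos (hall p)] at h1
      exact absurd (WithOne.coe_inj.1 h1) (by simp)
    have triples : ∀ (i : α → I) (g : α → G) (l : α → Λ), _ := fun i g l =>
      h fun x => triple (i x) (g x) (l x)
    simp only [wordValue_triple hM d _ _ _ p hp, wordValue_triple hM d _ _ _ q hq] at triples
    refine ⟨⟨fun x => ⟨content hq (fun e => (h e).symm) x, content hp h x⟩, fun i l => ?_⟩,
      fun g => ?_⟩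
    · have := triples i (fun _ => 1) l
      split_ifs at this with h1 h2 h2
      · have := WithOne.coe_inj.1 this
        simp only [triple.injEq] at this
        exact ⟨iff_of_true h1 h2, fun _ => ⟨this.1, this.2.2⟩⟩
      · exact absurd (WithOne.coe_inj.1 this) (by simp)
      · exact absurd (WithOne.coe_inj.1 this) (by simp)
      · exact ⟨iff_of_false h1 h2, fun h => (h1 h).elim⟩
    · have := triples (fun _ => i₀) g fun _ => l₀
      rw [if_pos (hall p), if_pos (hall q)] at this
      have := WithOne.coe_inj.1 this
      simp only [triple.injEq] at this
      exact this.2.1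
  · rintro ⟨⟨h1, h2⟩, h3⟩ e
    by_cases hz : ∃ x ∈ p, e x = zero
    · obtain ⟨x, hx, hxe⟩ := hz
      rw [wordValue_eq_zero hx hxe, wordValue_eq_zero ((h1 x).1 hx) hxe]
    · push Not at hz
      have : ∀ x, ∃ (i : I) (g : G) (l : Λ), x ∈ p → e x = triple i g l := by
        intro x
        by_cases hx : x ∈ p
        · rcases he : e x with _ | ⟨i, g, l⟩
          · exact (hz x hx he).elim
          · exact ⟨i, g, l, fun _ => rfl⟩
        · exact ⟨i₀, 1, l₀, fun h => (hx h).elim⟩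
      choose i g l he using this
      rw [wordValue_congr he, wordValue_congr fun x hx => he x ((h1 x).2 hx),
        wordValue_triple hM d i g l p hp, wordValue_triple hM d i g l q hq]
      obtain ⟨h4, h5⟩ := h2 i l
      by_cases hc : p.IsChain fun x y => M (l x) (i y) ≠ 0
      · rw [if_pos hc, if_pos (h4.1 hc), (h5 hc).1, (h5 hc).2, h3]
      · rw [if_neg hc, if_neg (fun h => hc (h4.2 h))]

/-! ### Words over a maximal subgroup -/

/-- The isomorphism of `G` with a maximal subgroup of the Rees matrix semigroup, given by a nonzero
entry `m` of the matrix. -/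
def embed (M : Matrix Λ I (WithZero G)) (i : I) (l : Λ) (m g : G) : ReesMatrixSemigroup M :=
  triple i (g * m⁻¹) l

theorem embed_injective (i : I) (l : Λ) (m : G) : Function.Injective (embed M i l m) := by
  intro g h hgh
  simpa [embed] using hgh

theorem embed_mul {i : I} {l : Λ} {m : G} (hm : M l i = (m : WithZero G)) (g h : G) :
    embed M i l m g * embed M i l m h = embed M i l m (g * h) := by
  rw [embed, embed, triple_mul hm, embed]
  simp [mul_assoc]

/-- The factor in front is essential: an empty product is the adjoined `1` of `WithOne`, not the
identity of the maximal subgroup. -/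
theorem coe_embed_mul_prod {i : I} {l : Λ} {m : G} (hm : M l i = (m : WithZero G)) {α : Type*}
    {F : α → WithOne (ReesMatrixSemigroup M)} {f : α → G} : ∀ (L : List α) (g : G),
      (∀ x ∈ L, F x = (embed M i l m (f x) : ReesMatrixSemigroup M)) →
      ((embed M i l m g : ReesMatrixSemigroup M) : WithOne (ReesMatrixSemigroup M)) *
        (L.map F).prod = (embed M i l m (g * (L.map f).prod) : ReesMatrixSemigroup M)
  | [], g, _ => by simp
  | x :: L, g, h => by
    rw [List.map_cons, List.prod_cons, h x List.mem_cons_self, ← mul_assoc, ← WithOne.coe_mul,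
      embed_mul hm, coe_embed_mul_prod hm L _ fun y hy => h y (List.mem_cons_of_mem _ hy)]
    simp [mul_assoc]

theorem coe_embed_pow {i : I} {l : Λ} {m : G} (hm : M l i = (m : WithZero G)) (g : G) (k : ℕ) :
    ((embed M i l m g : ReesMatrixSemigroup M) : WithOne (ReesMatrixSemigroup M)) ^ (k + 1) =
      (embed M i l m (g ^ (k + 1)) : ReesMatrixSemigroup M) := by
  induction k with
  | zero => simp
  | succ k ih => rw [pow_succ, ih, ← WithOne.coe_mul, embed_mul hm, ← pow_succ]

end ReesMatrixSemigroup

/-! ### Substituting elements of maximal subgroups -/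

/-- The word that replaces a variable or an inverse of a variable. -/
def block {α β : Type*} (K : ℕ) (z : β) (f : α → β) (s : Bool × α) : List β :=
  bif s.1 then [z, f s.2, z] else (List.replicate (K + 1) [z, f s.2, z]).flatten

/-- The word that replaces `X`, one of two signed words `P` and `Q`. -/
def substWord {α β : Type*} (K : ℕ) (z : β) (f : α → β) (P Q X : List (Bool × α)) : List β :=
  -- The factors before the blocks of `X` depend only on `P` and `Q`. They vanish if any block does,
  -- and are the identity of a maximal subgroup otherwise.
  List.replicate (K + 2) z ++
    ((P ++ Q).flatMap (fun s => (List.replicate (K + 2) (block K z f s)).flatten) ++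
      X.flatMap (block K z f))

/-- The value of a signed letter in a group. -/
def signedValue {α G : Type*} [Group G] (g : α → G) (s : Bool × α) : G :=
  bif s.1 then g s.2 else (g s.2)⁻¹

section substWord

variable {α β γ : Type*}

theorem map_block (h : β → γ) (K : ℕ) (z : β) (f : α → β) (s : Bool × α) :
    (block K z f s).map h = block K (h z) (fun x => h (f x)) s := by
  rcases s with ⟨_ | _, x⟩ <;> simp [block, List.map_flatten]

theorem map_substWord (h : β → γ) (K : ℕ) (z : β) (f : α → β) (P Q X : List (Bool × α)) :
    (substWord K z f P Q X).map h = substWord K (h z) (fun x => h (f x)) P Q X := by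
  simp [substWord, List.map_flatMap, List.map_flatten, map_block]

theorem substWord_map (h : γ → α) (K : ℕ) (z : β) (f : α → β) (P Q X : List (Bool × γ)) :
    substWord K z f (P.map (Prod.map id h)) (Q.map (Prod.map id h)) (X.map (Prod.map id h)) =
      substWord K z (fun x => f (h x)) P Q X := by
  have hb : ∀ s, block K z f (Prod.map id h s) = block K z (fun x => f (h x)) s := fun _ => rfl
  simp [substWord, List.flatMap_map, hb, ← List.map_append]

variable {G I Λ : Type*} [Group G] {M : Matrix Λ I (WithZero G)}

open ReesMatrixSemigroup

theorem prod_block {S : Type*} [Monoid S] (K : ℕ) (z : S) (f : α → S) (s : Bool × α) :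
    (block K z f s).prod = (z * f s.2 * z) ^ (bif s.1 then 1 else K + 1) := by
  rcases s with ⟨_ | _, x⟩ <;> simp [block, List.prod_flatten, mul_assoc]

theorem prod_substWord {S : Type*} [Monoid S] (K : ℕ) (z : S) (f : α → S)
    (P Q X : List (Bool × α)) : (substWord K z f P Q X).prod = z ^ (K + 2) *
      (((P ++ Q).map fun s => (block K z f s).prod ^ (K + 2)).prod *
        (X.map fun s => (block K z f s).prod).prod) := by
  have : ∀ (L : List (Bool × α)) (h : Bool × α → List S), (L.flatMap h).prod =
      (L.map fun x => (h x).prod).prod := by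
    intro L h
    induction L with
    | nil => rfl
    | cons x L ih => simp [ih]
  simp only [substWord, List.prod_append, this, List.prod_replicate, List.prod_flatten,
    List.map_replicate]

/-- Inside one maximal subgroup the prefix collapses by `hK`, and the power `K + 1` of a block is an
inverse, so only the signed word `X` remains. -/
theorem prod_substWord_embed {i : I} {l : Λ} {m : G} (hm : M l i = (m : WithZero G)) {K : ℕ}
    (hK : ∀ g : G, g ^ (K + 2) = 1) {z : ReesMatrixSemigroup M} {z' : G} (hz : z = embed M i l m z')
    {f : α → ReesMatrixSemigroup M} {g : α → G} {P Q X : List (Bool × α)}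
    (hX : X ⊆ P ++ Q) (hf : ∀ s ∈ P ++ Q, z * f s.2 * z = embed M i l m (g s.2)) :
    (substWord K (z : WithOne (ReesMatrixSemigroup M)) (fun x => f x) P Q X).prod =
      (embed M i l m (X.map (signedValue g)).prod : ReesMatrixSemigroup M) := by
  have hblock : ∀ s ∈ P ++ Q,
      (block K (z : WithOne (ReesMatrixSemigroup M)) (fun x => (f x : WithOne _)) s).prod =
        (embed M i l m (signedValue g s) : ReesMatrixSemigroup M) := by
    intro s hs
    rw [prod_block, ← WithOne.coe_mul, ← WithOne.coe_mul, hf s hs]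
    rcases s with ⟨_ | _, x⟩
    · simp only [cond_false, coe_embed_pow hm, signedValue]
      rw [eq_inv_of_mul_eq_one_left (a := g x ^ (K + 1)) (b := g x) (by rw [← pow_succ, hK])]
    · simp [signedValue]
  rw [prod_substWord, hz, coe_embed_pow hm, hK, ← mul_assoc, ← hz,
    coe_embed_mul_prod hm (f := fun _ => 1) (P ++ Q) 1 (fun s hs => by
      rw [hblock s hs, coe_embed_pow hm, hK]),
    coe_embed_mul_prod hm (f := signedValue g) X _ (fun s hs => hblock s (hX hs))]
  simp

/-- The substituted words are equal as functions on the Rees matrix semigroup if and only if the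
original signed words are equal as functions on the group. -/
theorem forall_prod_substWord_iff [Nonempty I] (hreg : IsRegularMatrix M) {K : ℕ}
    (hK : ∀ g : G, g ^ (K + 2) = 1) {z : β} {f : α → β} (hf : Function.Injective f)
    (hz : ∀ x, f x ≠ z) (P Q : List (Bool × α)) :
    (∀ e : β → ReesMatrixSemigroup M, wordValue e (substWord K z f P Q P ++ [z]) =
        wordValue e (substWord K z f P Q Q ++ [z])) ↔
      ∀ g : α → G, (P.map (signedValue g)).prod = (Q.map (signedValue g)).prod := by
  have hP : P ⊆ P ++ Q := List.subset_append_left _ _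
  have hQ : Q ⊆ P ++ Q := List.subset_append_right _ _
  constructor
  · intro h g
    obtain ⟨i⟩ := ‹Nonempty I›
    obtain ⟨l, hl⟩ := hreg.2 i
    obtain ⟨m, hm⟩ := WithZero.ne_zero_iff_exists.1 hl
    classical
    -- Put the identity of the maximal subgroup for `z` and the copy of `g x` for `f x`; this is
    -- consistent because `f` is injective and avoids `z`.
    have h1 := h fun b => embed M i l m (if hb : ∃ x, f x = b then g hb.choose else 1)
    simp only [wordValue_append, wordValue_singleton] at h1
    simp only [wordValue, map_substWord] at h1
    have hz' : ¬ ∃ x, f x = z := fun ⟨x, hx⟩ => hz x hx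
    have hfx : ∀ x, embed M i l m (if hb : ∃ y, f y = f x then g hb.choose else 1) =
        embed M i l m (g x) := fun x => by
      have hb : ∃ y, f y = f x := ⟨x, rfl⟩
      rw [dif_pos hb, hf hb.choose_spec]
    simp only [hfx, dif_neg hz'] at h1
    have hval : ∀ s ∈ P ++ Q, embed M i l m 1 * embed M i l m (g s.2) * embed M i l m 1 =
        embed M i l m (g s.2) := fun s _ => by
      rw [embed_mul hm.symm, embed_mul hm.symm]; simp
    rw [prod_substWord_embed hm.symm hK rfl hP hval, prod_substWord_embed hm.symm hK rfl hQ hval,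
      ← WithOne.coe_mul, ← WithOne.coe_mul, embed_mul hm.symm, embed_mul hm.symm] at h1
    simpa using embed_injective i l m (WithOne.coe_inj.1 h1)
  · intro h e
    rw [wordValue_append, wordValue_append]
    congr 1
    simp only [wordValue, map_substWord]
    -- If `z ^ (K + 2)` or some `z x z` vanishes, so does the common prefix, and both sides are `0`.
    by_cases hzero : ((zero : ReesMatrixSemigroup M) : WithOne (ReesMatrixSemigroup M)) =
        (e z : WithOne _) ^ (K + 2) ∨ ∃ s ∈ P ++ Q, e z * e (f s.2) * e z = zero
    · have key : ∀ X, (substWord K (e z : WithOne (ReesMatrixSemigroup M)) (fun x => e (f x))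
          P Q X).prod = (zero : ReesMatrixSemigroup M) := by
        intro X
        have hpow : ∀ k : ℕ, ((zero : ReesMatrixSemigroup M) :
            WithOne (ReesMatrixSemigroup M)) ^ (k + 1) = (zero : ReesMatrixSemigroup M) := fun k => by
          rw [pow_succ, mul_coe_zero]
        rw [prod_substWord]
        rcases hzero with h1 | ⟨s, hs, h1⟩
        · rw [← h1, coe_zero_mul]
        · rw [prod_eq_zero (L := (P ++ Q).map _), coe_zero_mul, mul_coe_zero]
          refine List.mem_map.2 ⟨s, hs, ?_⟩
          rw [prod_block, ← WithOne.coe_mul, ← WithOne.coe_mul, h1]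
          rcases s with ⟨_ | _, x⟩ <;> simp only [cond_true, cond_false, hpow]
      rw [key, key]
    · push Not at hzero
      obtain ⟨hz1, hz2⟩ := hzero
      rcases hez : e z with _ | ⟨i, t, l⟩
      · rw [hez, pow_succ, mul_coe_zero] at hz1
        exact (hz1 rfl).elim
      rcases hm : M l i with _ | m
      -- The exponent is at least `2`, so `z * z` occurs in the power and forces `M l i ≠ 0`.
      · rw [hez, pow_add, pow_two, ← WithOne.coe_mul, triple_mul_eq_zero hm, mul_coe_zero] at hz1
        exact (hz1 rfl).elim
      have hval : ∀ x, ∃ g : G, x ∈ (P ++ Q).map Prod.snd →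
          triple i t l * e (f x) * triple i t l = embed M i l m g := by
        intro x
        by_cases hx : x ∈ (P ++ Q).map Prod.snd
        · obtain ⟨s, hs, rfl⟩ := List.mem_map.1 hx
          have h1 := hz2 s hs
          rw [hez] at h1
          rcases hex : e (f s.2) with _ | ⟨j, u, k⟩
          · rw [hex, ReesMatrixSemigroup.mul_zero, ReesMatrixSemigroup.zero_mul] at h1
            exact (h1 rfl).elim
          rw [hex] at h1
          rcases h2 : M l j with _ | a
          · rw [triple_mul_eq_zero h2, ReesMatrixSemigroup.zero_mul] at h1
            exact (h1 rfl).elim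
          rw [triple_mul h2] at h1 ⊢
          rcases h3 : M k i with _ | b
          · rw [triple_mul_eq_zero h3] at h1
            exact (h1 rfl).elim
          exact ⟨t * a * u * b * t * m, fun _ => by rw [triple_mul h3]; simp [embed]⟩
        · exact ⟨1, fun h => (hx h).elim⟩
      choose g hg using hval
      have hzt : triple i t l = embed M i l m (t * m) := by simp [embed]
      have hg' : ∀ s ∈ P ++ Q, triple i t l * e (f s.2) * triple i t l = embed M i l m (g s.2) :=
        fun s hs => hg s.2 (List.mem_map_of_mem hs)
      rw [prod_substWord_embed hm hK hzt hP hg', prod_substWord_embed hm hK hzt hQ hg', h g]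

end substWord
end TermEquivalence

namespace TermEquivalence

open Turing
open FirstOrder

/-! ### Reading and writing terms -/

/-- Every finite type that is not too large is represented by leaves. -/
@[reducible]
noncomputable def finRepOfCard (α : Type) [Finite α] [Nonempty α] (h : Nat.card α ≤ 16) :
    FinRep α where
  code a := Fin.castLE h (Finite.equivFin α a)
  decode := Function.invFun fun a => Fin.castLE h (Finite.equivFin α a)
  decode_code := Function.leftInverse_invFun
    ((Fin.castLE_injective h).comp (Finite.equivFin α).injective)

/-- Each of the two terms uses at most three operation symbols and three symbols for variables. The
12 symbols fit into the 16 leaf labels of `Tree`. -/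
theorem card_symbols_le {L : FirstOrder.Language.{0, 0}} [Finite (Σ i, L.Functions i)]
    (h : Nat.card (Σ i, L.Functions i) ≤ 3) : Nat.card (TermSymbol L ⊕ TermSymbol L) ≤ 16 := by
  simp only [Nat.card_sum, Nat.card_eq_fintype_card, Fintype.card_option, Fintype.card_bool]
  omega

instance {L : FirstOrder.Language.{0, 0}} : Nonempty (TermSymbol L ⊕ TermSymbol L) := ⟨.inl (.inr none)⟩

theorem card_semigroupFunctions_le : Nat.card (Σ i, semigroupLanguage.Functions i) ≤ 3 := by
  have : Subsingleton (Σ i, semigroupLanguage.Functions i) :=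
    ⟨by rintro ⟨_, ⟨⟩⟩ ⟨_, ⟨⟩⟩; rfl⟩
  exact (Finite.card_le_one_iff_subsingleton.2 this).trans (by norm_num)

theorem card_groupFunctions_le : Nat.card (Σ i, groupLanguage.Functions i) ≤ 3 := by
  have := Nat.card_le_card_of_surjective
    (fun k : Fin 3 => (![⟨2, GroupFunc.mul⟩, ⟨1, GroupFunc.inv⟩, ⟨0, GroupFunc.one⟩] k :
      Σ i, GroupFunc i))
    (by
      rintro ⟨_, _ | _ | _⟩
      · exact ⟨0, rfl⟩
      · exact ⟨1, rfl⟩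
      · exact ⟨2, rfl⟩)
  exact this.trans (by simp)

/-- The symbols of pairs of semigroup terms. -/
abbrev SgSym : Type := TermSymbol semigroupLanguage ⊕ TermSymbol semigroupLanguage

/-- The symbols of pairs of group terms. -/
abbrev GpSym : Type := TermSymbol groupLanguage ⊕ TermSymbol groupLanguage

noncomputable instance : FinRep SgSym :=
  finRepOfCard _ (card_symbols_le card_semigroupFunctions_le)

noncomputable instance : FinRep GpSym :=
  finRepOfCard _ (card_symbols_le card_groupFunctions_le)

theorem PT.foldr_symbols {ι σ : Type} [FinRep ι] [Rep σ] {step : ι → σ → σ} (s : σ) (k : ℕ)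
    (h : ∀ a, PT (step a)) (hk : ∀ a c, sz (step a c) ≤ sz c + k) :
    PT (fun w : List ι => w.foldr step s) :=
  PT.foldr_add (h := fun _ a c => step a c) PT.id (PT.const s)
    (PT.dispatch (α := List ι × ι × σ) (g := fun a x => step a x.2.2) PT.snd.fst'
      fun a => (h a).comp PT.snd.snd') (Polynomial.C k) (fun x c y _ => by simpa using hk y c)

/-- Only read the symbols of one of the two terms. -/
def onSide {A σ : Type} (c : Bool) (h : A → σ → σ) : A ⊕ A → σ → σ
  | .inl a, s => bif c then s else h a s
  | .inr a, s => bif c then h a s else s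

theorem foldr_onSide {A σ : Type} (h : A → σ → σ) (s : σ) (u v : List A) (c : Bool) :
    (u.map Sum.inl ++ v.map Sum.inr).foldr (onSide c h) s = (bif c then v else u).foldr h s := by
  have hid : ∀ (l : List A), l.foldr (fun _ s => s) s = s := fun l => by
    induction l with
    | nil => rfl
    | cons a l ih => simp
  cases c
  · simp [List.foldr_append, List.foldr_map, onSide, hid]
  · have hid : ∀ (l : List A) (s : σ), l.foldr (fun _ s => s) s = s := fun l s => by
      induction l with
      | nil => rfl
      | cons a l ih => simp
    simp [List.foldr_append, List.foldr_map, onSide, hid]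

theorem PT.onSide {A σ : Type} [Rep σ] {h : A → σ → σ} (hh : ∀ a, PT (h a)) (c : Bool)
    (a : A ⊕ A) : PT (onSide c h a) := by
  rcases a with a | a <;> cases c
  exacts [hh a, PT.id, PT.id, hh a]

theorem sz_onSide_le {A σ : Type} [Rep σ] {h : A → σ → σ} {k : ℕ}
    (hh : ∀ a s, sz (h a s) ≤ sz s + k) (c : Bool) (a : A ⊕ A) (s : σ) :
    sz (TermEquivalence.onSide c h a s) ≤ sz s + k := by
  rcases a with a | a <;> cases c
  exacts [hh a s, Nat.le_add_right _ _, Nat.le_add_right _ _, hh a s]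

section variableWord

variable {L : FirstOrder.Language.{0, 0}}

/-- The variables of a term, from left to right. -/
def variableWord (t : L.Term ℕ) : List ℕ := t.listEncode.filterMap Sum.getLeft?

/-- One step of reading the names of the variables of a term, from right to left. -/
def wordStep : TermSymbol L → List Bool × List (List Bool) → List Bool × List (List Bool)
  | .inl _, s => ([], s.2)
  | .inr none, s => ([], s.1 :: s.2)
  | .inr (some b), s => (b :: s.1, s.2)

theorem foldr_wordStep_tokens (t : List (ℕ ⊕ (Σ i, L.Functions i))) :
    (t.flatMap encodeToken).foldr wordStep ([], []) =
      ([], (t.filterMap Sum.getLeft?).map Computability.encodeNat) := by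
  have bits : ∀ (l : List Bool) (m : List (List Bool)), List.foldr wordStep ([], m)
      (l.map fun b => (Sum.inr (some b) : TermSymbol L)) = (l, m) := by
    intro l m
    induction l with
    | nil => rfl
    | cons b l ih => rw [List.map_cons, List.foldr_cons, ih]; rfl
  induction t with
  | nil => rfl
  | cons a t ih =>
    rw [List.flatMap_cons, List.foldr_append, ih]
    cases a with
    | inl n => rw [encodeToken, List.foldr_cons, bits]; rfl
    | inr f => rfl

/-- The names of the variables of one of two terms. -/
def readWord (c : Bool) (w : List (TermSymbol L ⊕ TermSymbol L)) : List (List Bool) :=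
  (w.foldr (onSide c wordStep) ([], [])).2

theorem readWord_encode (c : Bool) (p q : L.Term ℕ) :
    readWord c ((Computability.encodingProd (termEncoding L) (termEncoding L)).encode (p, q)) =
      (variableWord (bif c then q else p)).map Computability.encodeNat := by
  change ((((termEncoding L).encode p).map Sum.inl ++ ((termEncoding L).encode q).map Sum.inr).foldr
    (onSide c wordStep) ([], [])).2 = _
  rw [foldr_onSide]
  cases c <;> exact congrArg Prod.snd (foldr_wordStep_tokens _)

theorem PT.readWord [FinRep (TermSymbol L ⊕ TermSymbol L)] (c : Bool) :
    PT (readWord (L := L) c) := by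
  refine (PT.foldr_symbols (step := TermEquivalence.onSide c (wordStep (L := L))) ([], []) 3
    (PT.onSide (fun a => ?_) c) (sz_onSide_le (fun a s => ?_) c)).snd'
  · rcases a with f | _ | b
    · exact (PT.const []).pair PT.snd
    · exact (PT.const []).pair (PT.fst.cons PT.snd)
    · exact ((PT.const b).cons PT.fst).pair PT.snd
  · rcases s with ⟨u, v⟩
    have := one_le_sz u
    rcases a with f | _ | b <;> simp [wordStep] <;> omega

end variableWord

/-! ### Semigroup terms -/

/-- The product of two semigroup terms. -/
def mulTerm (t u : semigroupLanguage.Term ℕ) : semigroupLanguage.Term ℕ :=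
  .func (SemigroupFunc.mul : semigroupLanguage.Functions 2) ![t, u]

theorem exists_eq_mulTerm {n : ℕ} (f : semigroupLanguage.Functions n)
    (ts : Fin n → semigroupLanguage.Term ℕ) :
    ∃ (t u : semigroupLanguage.Term ℕ), (∃ i, ts i = t) ∧ (∃ i, ts i = u) ∧
      FirstOrder.Language.Term.func f ts = mulTerm t u := by
  cases f
  refine ⟨ts 0, ts 1, ⟨0, rfl⟩, ⟨1, rfl⟩, ?_⟩
  unfold mulTerm
  congr 1
  funext i
  fin_cases i <;> rfl

theorem semigroupTerm_induction {P : semigroupLanguage.Term ℕ → Prop}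
    (var : ∀ n, P (.var n)) (mul : ∀ t u, P t → P u → P (mulTerm t u)) : ∀ t, P t := by
  intro t
  induction t with
  | var n => exact var n
  | func f ts ih =>
    obtain ⟨t, u, ⟨i, hi⟩, ⟨j, hj⟩, h⟩ := exists_eq_mulTerm f ts
    rw [h]
    exact mul t u (hi ▸ ih i) (hj ▸ ih j)

theorem listEncode_mulTerm (t u : semigroupLanguage.Term ℕ) : (mulTerm t u).listEncode =
    Sum.inr ⟨2, (SemigroupFunc.mul : semigroupLanguage.Functions 2)⟩ ::
      (t.listEncode ++ u.listEncode) := by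
  simp [mulTerm, FirstOrder.Language.Term.listEncode, List.finRange_succ]

theorem variableWord_mulTerm (t u : semigroupLanguage.Term ℕ) :
    variableWord (mulTerm t u) = variableWord t ++ variableWord u := by
  rw [variableWord, listEncode_mulTerm, List.filterMap_cons_none rfl, List.filterMap_append]
  rfl

theorem variableWord_var {L : FirstOrder.Language.{0, 0}} (n : ℕ) :
    variableWord (.var n : L.Term ℕ) = [n] := rfl

theorem variableWord_ne_nil (t : semigroupLanguage.Term ℕ) : variableWord t ≠ [] := by
  induction t using semigroupTerm_induction with
  | var n => simp [variableWord_var]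
  | mul t u h _ => simp [variableWord_mulTerm, h]

theorem realize_mulTerm {S : Type*} [Semigroup S] (e : ℕ → S) (t u : semigroupLanguage.Term ℕ) :
    (mulTerm t u).realize e = t.realize e * u.realize e := rfl

theorem coe_realize {S : Type*} [Semigroup S] (e : ℕ → S) (t : semigroupLanguage.Term ℕ) :
    ((t.realize e : S) : WithOne S) = wordValue e (variableWord t) := by
  induction t using semigroupTerm_induction with
  | var n => simp [variableWord_var, wordValue]
  | mul t u h1 h2 =>
    rw [realize_mulTerm, variableWord_mulTerm, wordValue_append, WithOne.coe_mul, h1, h2]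

/-- The operation symbol of semigroups as an operation symbol of groups. -/
def groupLHom : semigroupLanguage →ᴸ groupLanguage where
  onFunction := fun _ f => match f with
    | SemigroupFunc.mul => GroupFunc.mul
  onRelation := fun _ r => Empty.elim r

theorem listEncode_onTerm (t : semigroupLanguage.Term ℕ) : (groupLHom.onTerm t).listEncode =
    t.listEncode.map (Sum.map id fun f => ⟨f.1, groupLHom.onFunction f.2⟩) := by
  induction t with
  | var n => rfl
  | func f ts ih =>
    simp [FirstOrder.Language.LHom.onTerm, FirstOrder.Language.Term.listEncode, ih, List.map_flatMap]

theorem realize_onTerm {G : Type*} [Group G] (g : ℕ → G) (t : semigroupLanguage.Term ℕ) :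
    (groupLHom.onTerm t).realize g = ((variableWord t).map g).prod := by
  induction t using semigroupTerm_induction with
  | var n => simp [variableWord_var, FirstOrder.Language.LHom.onTerm]
  | mul t u h1 h2 =>
    rw [variableWord_mulTerm, List.map_append, List.prod_append, ← h1, ← h2]
    rfl

/-- A symbol of a semigroup term as a symbol of a group term. -/
def groupSymbol : SgSym → GpSym :=
  Sum.map (Sum.map (fun f => ⟨f.1, groupLHom.onFunction f.2⟩) id)
    (Sum.map (fun f => ⟨f.1, groupLHom.onFunction f.2⟩) id)

theorem encode_onTerm (t : semigroupLanguage.Term ℕ) :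
    (termEncoding groupLanguage).encode (groupLHom.onTerm t) =
      ((termEncoding semigroupLanguage).encode t).map
        (Sum.map (fun f => ⟨f.1, groupLHom.onFunction f.2⟩) id) := by
  change List.flatMap _ _ = List.map _ (List.flatMap _ _)
  rw [listEncode_onTerm, List.flatMap_map, List.map_flatMap]
  congr 1
  funext a
  rcases a with n | f
  · simp [encodeToken]
  · rfl

/-- The product of a word of variables and the variable `x_0`. -/
def wordTerm (w : List ℕ) : semigroupLanguage.Term ℕ :=
  w.foldr (fun n t => mulTerm (.var n) t) (.var 0)

theorem variableWord_wordTerm (w : List ℕ) : variableWord (wordTerm w) = w ++ [0] := by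
  induction w with
  | nil => rfl
  | cons n w ih =>
    change variableWord (mulTerm _ (wordTerm w)) = _
    rw [variableWord_mulTerm, ih, variableWord_var]
    rfl

/-- The string of the product of variables with given names and the variable `x_0`. -/
def emit (w : List (List Bool)) : List (TermSymbol semigroupLanguage) :=
  (w.flatMap fun x => .inl ⟨2, SemigroupFunc.mul⟩ :: .inr none :: x.map fun b => .inr (some b)) ++
    [.inr none]

theorem encode_wordTerm (w : List ℕ) :
    (termEncoding semigroupLanguage).encode (wordTerm w) =
      emit (w.map Computability.encodeNat) := by
  change List.flatMap encodeToken (FirstOrder.Language.Term.listEncode _) = _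
  induction w with
  | nil => rfl
  | cons n w ih =>
    change List.flatMap encodeToken (FirstOrder.Language.Term.listEncode (mulTerm _ (wordTerm w))) = _
    rw [listEncode_mulTerm, List.flatMap_cons, List.flatMap_append, ih]
    simp [encodeToken, FirstOrder.Language.Term.listEncode, emit]

theorem PT.map_emit {α : Type} [Rep α] (h : TermSymbol semigroupLanguage → SgSym)
    {f : α → List (List Bool)} (hf : PT f) : PT (fun x => (emit (f x)).map h) := by
  have := (PT.flatMap (f := fun (_ : α) (x : List Bool) =>
    h (.inl ⟨2, SemigroupFunc.mul⟩) :: h (.inr none) :: x.map fun b => h (.inr (some b))) hf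
    ((PT.const _).cons ((PT.const _).cons
      (PT.map (f := fun _ b => h (.inr (some b))) PT.snd
        ((PT.ofFin fun b => h (.inr (some b))).comp PT.snd))))).append (PT.const [h (.inr none)])
  refine this.of_eq fun x => ?_
  simp [emit, List.map_flatMap, Function.comp_def]

/-! ### Group terms -/

/-- The inverse of a signed word. -/
def invert {α : Type} (u : List (Bool × α)) : List (Bool × α) :=
  (u.map fun s => (!s.1, s.2)).reverse

theorem map_invert {α β : Type} (h : α → β) (u : List (Bool × α)) :
    (invert u).map (Prod.map id h) = invert (u.map (Prod.map id h)) := by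
  simp [invert, Function.comp_def]

theorem prod_invert {α : Type} {G : Type*} [Group G] (g : α → G) (u : List (Bool × α)) :
    ((invert u).map (signedValue g)).prod = ((u.map (signedValue g)).prod)⁻¹ := by
  induction u with
  | nil => simp [invert]
  | cons s u ih =>
    have : invert (s :: u) = invert u ++ [(!s.1, s.2)] := by simp [invert]
    rw [this, List.map_append, List.prod_append, ih]
    rcases s with ⟨_ | _, x⟩ <;> simp [signedValue]

/-- The signed word of a group term. -/
def signedWord : groupLanguage.Term ℕ → List (Bool × ℕ)
  | .var n => [(true, n)]
  | .func GroupFunc.mul ts => signedWord (ts 0) ++ signedWord (ts 1)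
  | .func GroupFunc.inv ts => invert (signedWord (ts 0))
  | .func GroupFunc.one _ => []

theorem realize_eq_signedWord {G : Type*} [Group G] (g : ℕ → G) : ∀ t : groupLanguage.Term ℕ,
    t.realize g = ((signedWord t).map (signedValue g)).prod
  | .var n => by simp [signedWord, signedValue]
  | .func GroupFunc.mul ts => by
    rw [signedWord, List.map_append, List.prod_append, ← realize_eq_signedWord g (ts 0),
      ← realize_eq_signedWord g (ts 1)]
    rfl
  | .func GroupFunc.inv ts => by
    rw [signedWord, prod_invert, ← realize_eq_signedWord g (ts 0)]
    rfl
  | .func GroupFunc.one _ => rfl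

/-- Multiply the two topmost words. -/
def mulTop {α : Type} (l : List (List α)) : List (List α) :=
  match l with
  -- Stacks with fewer than two words do not arise from encoded terms; the value is arbitrary.
  | [] => []
  | u :: l' => match l' with
    | [] => []
    | v :: m => (u ++ v) :: m

/-- Invert the topmost word. -/
def invTop {α : Type} (l : List (List (Bool × α))) : List (List (Bool × α)) :=
  match l with
  | [] => []
  | u :: m => invert u :: m

/-- One step of reading the signed word of a group term, from right to left. -/
def groupStep : TermSymbol groupLanguage → List Bool × List (List (Bool × List Bool)) →
    List Bool × List (List (Bool × List Bool))
  | .inl ⟨_, GroupFunc.mul⟩, s => ([], mulTop s.2)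
  | .inl ⟨_, GroupFunc.inv⟩, s => ([], invTop s.2)
  | .inl ⟨_, GroupFunc.one⟩, s => ([], [] :: s.2)
  | .inr none, s => ([], [(true, s.1)] :: s.2)
  | .inr (some b), s => (b :: s.1, s.2)

/-- Polish notation read from right to left is evaluated with a stack: when an operation symbol is
met, its arguments are the topmost words. The statement is for any stack `m` below, as the left
argument is read on top of the right one. -/
theorem foldr_groupStep : ∀ (t : groupLanguage.Term ℕ) (m : List (List (Bool × List Bool))),
    (t.listEncode.flatMap encodeToken).foldr groupStep ([], m) =
      ([], (signedWord t).map (Prod.map id Computability.encodeNat) :: m)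
  | .var n, m => by
    have bits : ∀ (l : List Bool) (m : List (List (Bool × List Bool))), List.foldr groupStep ([], m)
        (l.map fun b => (Sum.inr (some b) : TermSymbol groupLanguage)) = (l, m) := by
      intro l m
      induction l with
      | nil => rfl
      | cons b l ih => rw [List.map_cons, List.foldr_cons, ih]; rfl
    have : (FirstOrder.Language.Term.listEncode (.var n : groupLanguage.Term ℕ)).flatMap encodeToken =
        Sum.inr none :: (Computability.encodeNat n).map fun b => Sum.inr (some b) := by
      simp [FirstOrder.Language.Term.listEncode, encodeToken]
    rw [this, List.foldr_cons, bits]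
    rfl
  | .func GroupFunc.mul ts, m => by
    have : (FirstOrder.Language.Term.listEncode (.func (GroupFunc.mul : groupLanguage.Functions 2) ts :
        groupLanguage.Term ℕ)).flatMap encodeToken = Sum.inl ⟨2, GroupFunc.mul⟩ ::
          ((ts 0).listEncode.flatMap encodeToken ++ (ts 1).listEncode.flatMap encodeToken) := by
      simp [FirstOrder.Language.Term.listEncode, encodeToken, List.finRange_succ]
    refine (congrArg _ this).trans ?_
    rw [List.foldr_cons, List.foldr_append, foldr_groupStep (ts 1), foldr_groupStep (ts 0)]
    simp [groupStep, mulTop, signedWord]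
  | .func GroupFunc.inv ts, m => by
    have : (FirstOrder.Language.Term.listEncode (.func (GroupFunc.inv : groupLanguage.Functions 1) ts :
        groupLanguage.Term ℕ)).flatMap encodeToken = Sum.inl ⟨1, GroupFunc.inv⟩ ::
          (ts 0).listEncode.flatMap encodeToken := by
      simp [FirstOrder.Language.Term.listEncode, encodeToken, List.finRange_succ]
    refine (congrArg _ this).trans ?_
    rw [List.foldr_cons, foldr_groupStep (ts 0)]
    simp [groupStep, invTop, signedWord, map_invert]
  | .func GroupFunc.one _, m => rfl

/-- The signed word of one of two group terms. -/
def readSigned (c : Bool) (w : List GpSym) : List (Bool × List Bool) :=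
  (w.foldr (onSide c groupStep) ([], [])).2.headD []

theorem readSigned_encode (c : Bool) (p q : groupLanguage.Term ℕ) :
    readSigned c ((Computability.encodingProd (termEncoding groupLanguage)
      (termEncoding groupLanguage)).encode (p, q)) =
      (signedWord (bif c then q else p)).map (Prod.map id Computability.encodeNat) := by
  change ((((termEncoding groupLanguage).encode p).map Sum.inl ++
    ((termEncoding groupLanguage).encode q).map Sum.inr).foldr
    (onSide c groupStep) ([], [])).2.headD [] = _
  rw [foldr_onSide]
  cases c
  · exact congrArg (fun s => s.2.headD []) (foldr_groupStep p [])
  · exact congrArg (fun s => s.2.headD []) (foldr_groupStep q [])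

/-! ### Polynomial time for reading group terms. -/

section PT

variable {α β γ : Type} [Rep α] [Rep β] [Rep γ]

theorem PT.headD {f : α → List β} (hf : PT f) (d : β) : PT (fun x => (f x).headD d) :=
  (PT.listCases (g := fun _ y _ => y) hf (PT.const d) PT.fst.fst').of_eq fun x => by
    cases f x <;> rfl

theorem PT.invert : PT (invert : List (Bool × α) → List (Bool × α)) :=
  PT.reverse.comp (PT.map (f := fun (_ : List (Bool × α)) (s : Bool × α) => (!s.1, s.2)) PT.id (PT.snd.fst'.not.pair PT.snd.snd'))

theorem sz_invert (u : List (Bool × α)) : sz (invert u) = sz u := by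
  rw [TermEquivalence.invert, sz_reverse]
  induction u with
  | nil => rfl
  | cons s u ih =>
    rcases s with ⟨b, x⟩
    simp [ih]

theorem PT.mulTop : PT (mulTop : List (List α) → List (List α)) := by
  have h : PT (fun x : (List α × List (List α)) × List (List α) =>
      match x.1.2 with
      | [] => []
      | v :: m => (x.1.1 ++ v) :: m) :=
    (PT.listCases (f := fun _ => [])
      (g := fun (x : (List α × List (List α)) × List (List α)) v m => (x.1.1 ++ v) :: m)
      PT.fst.snd' (PT.const _) ((PT.snd.fst'.fst'.append PT.fst.fst').cons PT.fst.snd')).of_eq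
      fun x => by rcases x with ⟨⟨_, _ | _⟩, _⟩ <;> rfl
  exact (PT.listCases (l := fun x => x) (f := fun _ => []) (g := fun _ u l' => match l' with
      | [] => []
      | v :: m => (u ++ v) :: m) PT.id (PT.const _) h).of_eq fun x => by cases x <;> rfl

/-- Multiplication and inversion of stored words do not increase the size, so reading a term adds
only a constant per symbol. -/
theorem sz_mulTop_le (l : List (List α)) : sz (mulTop l) ≤ sz l := by
  rcases l with _ | ⟨u, _ | ⟨v, m⟩⟩
  · exact le_rfl
  · simp [TermEquivalence.mulTop]
  · have := sz_append u v
    simp [TermEquivalence.mulTop]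
    omega

theorem PT.invTop : PT (invTop : List (List (Bool × α)) → List (List (Bool × α))) :=
  (PT.listCases (l := fun x => x) (f := fun _ => [])
    (g := fun _ u m => TermEquivalence.invert u :: m) PT.id (PT.const _)
    ((PT.invert.comp PT.fst.fst').cons PT.fst.snd')).of_eq fun x => by cases x <;> rfl

theorem sz_invTop_le (l : List (List (Bool × α))) : sz (invTop l) ≤ sz l := by
  rcases l with _ | ⟨u, m⟩
  · exact le_rfl
  · simp [TermEquivalence.invTop, sz_invert]

theorem PT.readSigned (c : Bool) : PT (readSigned c) := by
  refine PT.headD (PT.foldr_symbols (step := TermEquivalence.onSide c groupStep) ([], []) 10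
    (PT.onSide (fun a => ?_) c) (sz_onSide_le (fun a s => ?_) c)).snd' []
  · rcases a with ⟨_, _ | _ | _⟩ | _ | b
    · exact (PT.const []).pair (PT.mulTop.comp PT.snd)
    · exact (PT.const []).pair (PT.invTop.comp PT.snd)
    · exact (PT.const []).pair ((PT.const []).cons PT.snd)
    · exact (PT.const []).pair ((((PT.const true).pair PT.fst).cons (PT.const [])).cons PT.snd)
    · exact ((PT.const b).cons PT.fst).pair PT.snd
  · rcases s with ⟨u, v⟩
    have h1 := one_le_sz u
    have h2 := sz_mulTop_le v
    have h3 := sz_invTop_le v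
    rcases a with ⟨_, _ | _ | _⟩ | _ | b <;> simp [groupStep] <;> omega

/-! ### Polynomial time for the functions on words -/

theorem PT.flatten_replicate {f : α → List β} (hf : PT f) :
    ∀ k : ℕ, PT (fun x => (List.replicate k (f x)).flatten)
  | 0 => PT.const []
  | k + 1 => (hf.append (PT.flatten_replicate hf k)).of_eq fun x => by
    simp [List.replicate_succ]

theorem PT.block (K : ℕ) (z : β) {f : α → β} (hf : PT f) : PT (block K z f) := by
  have h : PT (fun s : Bool × α => [z, f s.2, z]) :=
    (PT.const z).cons ((hf.comp PT.snd).cons (PT.const [z]))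
  exact PT.cond PT.fst h (h.flatten_replicate _)

theorem PT.substWord (K : ℕ) (z : β) {f : α → β} (hf : PT f) {P Q X : γ → List (Bool × α)}
    (hP : PT P) (hQ : PT Q) (hX : PT X) : PT (fun x => substWord K z f (P x) (Q x) (X x)) :=
  (PT.const (List.replicate (K + 2) z)).append
    ((PT.flatMap (f := fun _ s => (List.replicate (K + 2) (TermEquivalence.block K z f s)).flatten)
      (hP.append hQ) (((PT.block K z hf).flatten_replicate _).comp PT.snd)).append
      (PT.flatMap (f := fun _ s => TermEquivalence.block K z f s) hX
        ((PT.block K z hf).comp PT.snd)))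

variable [DecidableEq α]

theorem PT.substPairs (h : PTEq α) : PT (fun x : (α × α) × List (α × α) =>
    substPairs x.1.1 x.1.2 x.2) := by
  have h1 : PT (fun x : (α × α) × α => subst x.1.1 x.1.2 x.2) :=
    PT.cond (h.decide_eq PT.snd PT.fst.snd') PT.fst.fst' PT.snd
  exact PT.map (f := fun (x : (α × α) × List (α × α)) e =>
    (subst x.1.1 x.1.2 e.1, subst x.1.1 x.1.2 e.2)) PT.snd
    ((h1.comp (PT.fst.fst'.pair PT.snd.fst')).pair (h1.comp (PT.fst.fst'.pair PT.snd.snd')))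

theorem PT.unifyStep (h : PTEq α) : PT (unifyStep (V := α)) :=
  (PT.listCases (f := fun x => x)
    (g := fun x e l => (TermEquivalence.substPairs e.1 e.2 l,
      TermEquivalence.substPairs e.1 e.2 x.2)) PT.fst PT.id
    (((PT.substPairs h).comp (PT.fst.fst'.pair PT.fst.snd')).pair
      ((PT.substPairs h).comp (PT.fst.fst'.pair PT.snd.snd')))).of_eq
    fun x => by rcases x with ⟨_ | _, _⟩ <;> rfl

/-- The length of the lists and the size of the vertices do not increase. -/
theorem sz_iterate_unifyStep_le (x : List (α × α) × List (α × α)) (k : ℕ) :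
    sz (unifyStep^[k] x) ≤ 2 * (sz x * (2 * sz x + 2) + 1) + 1 := by
  have key : ∀ k, (∀ e, e ∈ (unifyStep^[k] x).1 ∨ e ∈ (unifyStep^[k] x).2 →
      sz e.1 ≤ sz x ∧ sz e.2 ≤ sz x) ∧ (unifyStep^[k] x).1.length ≤ sz x ∧
      (unifyStep^[k] x).2.length ≤ sz x := by
    intro k
    induction k with
    | zero =>
      rcases x with ⟨E, T⟩
      have h1 := length_lt_sz E
      have h2 := length_lt_sz T
      refine ⟨fun e he => ?_, ?_, ?_⟩
      · have h3 : sz e ≤ sz E ∨ sz e ≤ sz T := he.imp sz_le_of_mem sz_le_of_mem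
        rcases e with ⟨a, b⟩
        simp at h3 ⊢
        omega
      all_goals simp; omega
    | succ k ih =>
      rw [Function.iterate_succ_apply']
      generalize unifyStep^[k] x = y at ih
      obtain ⟨h1, h2, h3⟩ := ih
      rcases y with ⟨_ | ⟨⟨a, b⟩, E⟩, T⟩
      · exact ⟨h1, h2, h3⟩
      · have hab := h1 (a, b) (Or.inl List.mem_cons_self)
        have hs : ∀ v, sz v ≤ sz x → sz (subst a b v) ≤ sz x := by
          intro v hv
          by_cases h : v = b <;> simp [subst, h, hab.1]
          exact hv
        refine ⟨fun e he => ?_, ?_, ?_⟩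
        · simp only [TermEquivalence.unifyStep, TermEquivalence.substPairs, List.mem_map] at he
          rcases he with ⟨e', he', rfl⟩ | ⟨e', he', rfl⟩
          · have := h1 e' (Or.inl (List.mem_cons_of_mem _ he'))
            exact ⟨hs _ this.1, hs _ this.2⟩
          · have := h1 e' (Or.inr he')
            exact ⟨hs _ this.1, hs _ this.2⟩
        · simp [TermEquivalence.unifyStep, TermEquivalence.substPairs] at h2 ⊢
          omega
        · simpa [TermEquivalence.unifyStep, TermEquivalence.substPairs] using h3
  obtain ⟨h1, h2, h3⟩ := key k
  generalize unifyStep^[k] x = y at h1 h2 h3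
  rcases y with ⟨E, T⟩
  have hp : ∀ e : α × α, (sz e.1 ≤ sz x ∧ sz e.2 ≤ sz x) → sz e ≤ 2 * sz x + 1 := by
    rintro ⟨a, b⟩ h
    simp at h ⊢
    omega
  have h4 := sz_le_of_forall (l := E) fun e he => hp e (h1 e (Or.inl he))
  have h5 := sz_le_of_forall (l := T) fun e he => hp e (h1 e (Or.inr he))
  have h6 := Nat.mul_le_mul_right (2 * sz x + 1 + 1) h2
  have h7 := Nat.mul_le_mul_right (2 * sz x + 1 + 1) h3
  rw [show 2 * sz x + 1 + 1 = 2 * sz x + 2 by omega] at h4 h5 h6 h7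
  simp only [sz_pair] at h6 h7 ⊢
  omega

theorem PT.unify (h : PTEq α) {E T : β → List (α × α)} (hE : PT E) (hT : PT T) :
    PT (fun x => unify (E x) (T x)) := by
  suffices PT (fun x : List (α × α) × List (α × α) => TermEquivalence.unify x.1 x.2) from
    this.comp (hE.pair hT)
  have := PT.iterate (l := fun x : List (α × α) × List (α × α) => x.1) (s := fun x => x)
    PT.fst PT.id (PT.unifyStep h)
    (2 * (Polynomial.X * (2 * Polynomial.X + 2) + 1) + 1) (fun x k _ => by
      simpa using sz_iterate_unifyStep_le x k)
  exact PT.all (p := fun _ e => decide (e.1 = e.2)) this.snd' (h.decide_eq PT.snd.fst' PT.snd.snd')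

omit [DecidableEq α] in
theorem PT.edges {w : β → List α} (hw : PT w) : PT (fun x => edges (w x)) := by
  suffices PT (TermEquivalence.edges (α := α)) from this.comp hw
  refine (PT.foldr_add (l := fun w : List α => w) (s := fun _ => ([], []))
    (h := fun _ x s => edgeStep x s) PT.id (PT.const _) ?_ (2 * Polynomial.X + 20) ?_).snd'
  · refine (((PT.const true).pair PT.snd.fst').cons (PT.const [])).pair ?_
    exact (PT.listCases (f := fun x : List α × α × List (Bool × α) ×
        List ((Bool × α) × (Bool × α)) => x.2.2.2)
      (g := fun x r _ => ((false, x.2.1), r) :: x.2.2.2) PT.snd.snd'.fst' PT.snd.snd'.snd'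
      ((((PT.const false).pair PT.snd.snd'.fst').pair PT.fst.fst').cons PT.snd.snd'.snd'.snd')).of_eq
      fun x => by rcases x with ⟨_, _, _ | _, _⟩ <;> rfl
  · rintro w ⟨_ | ⟨r, m⟩, l⟩ x hx
    all_goals
      have := sz_le_of_mem hx
      simp [edgeStep]
      omega

theorem PT.wordTest (h : PTEq α) (rect one rows cols : Bool) (d : α) {p q : β → List α}
    (hp : PT p) (hq : PT q) : PT (fun x => wordTest rect one rows cols d (p x) (q x)) := by
  have hV : PTEq (Bool × α) := PTEq.of_finRep.prod h
  have hlast : ∀ {w : β → List α}, PT w → PT (fun x => lastLetter (w x) d) := fun hw =>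
    PT.headD (PT.reverse.comp hw) d
  have hbool : ∀ (b : Bool) {γ : Type} [Rep γ] {f g : β → γ}, PT f → PT g →
      PT (fun x => bif b then f x else g x) := by
    intro b γ _ f g hf hg
    cases b
    exacts [hg, hf]
  refine ((h.subset hp hq).and (h.subset hq hp)).and (.and ?_ (.and ?_ ?_))
  · exact hbool _ (PT.const _) (h.decide_eq (hp.headD d) (hq.headD d))
  · exact hbool _ (PT.const _) (h.decide_eq (hlast hp) (hlast hq))
  · refine hbool _ (hbool _ (PT.const _) (.and (PT.unify hV hp.edges (hq.edges.append
      (.append (hbool _ (.cons (.pair (.pair (PT.const _) (hp.headD d))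
        (.pair (PT.const _) (hq.headD d))) (PT.const _)) (PT.const _))
      (hbool _ (.cons (.pair (.pair (PT.const _) (hlast hp))
        (.pair (PT.const _) (hlast hq))) (PT.const _)) (PT.const _)))))
      (PT.unify hV hq.edges hp.edges))) ?_
    exact ((PTEq.subset (hV.prod hV) hp.edges hq.edges).and
      (PTEq.subset (hV.prod hV) hq.edges hp.edges)).of_eq fun x => by congr!

end PT
end TermEquivalence

namespace TermEquivalence

open Turing

/-! ### The reductions -/

theorem cast_bit1 (m : Num) : ((Num.bit1 m : Num) : ℕ) = 2 * (m : ℕ) + 1 := by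
  cases m with
  | zero => rfl
  | pos p =>
    change (p : ℕ) + (p : ℕ) + 1 = 2 * (p : ℕ) + 1
    ring

/-- Digits start with the least significant one, so renaming `x_n` to `x_{2n+1}` prepends a single
bit to the name. The variable `x_0`, with the empty name, stays free for `z`. -/
theorem encodeNat_two_mul_add_one (n : ℕ) :
    Computability.encodeNat (2 * n + 1) = true :: Computability.encodeNat n := by
  unfold Computability.encodeNat
  have h : ((2 * n + 1 : ℕ) : Num) = Num.bit1 (n : Num) := by
    apply Num.to_nat_inj.1
    rw [cast_bit1, Num.to_of_nat, Num.to_of_nat]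
  rw [h]
  cases (n : Num) <;> rfl

section reductions

variable {G : Type*} [Group G] {I Λ : Type*} {M : Matrix Λ I (WithZero G)}

theorem termEq_group_iff (p q : groupLanguage.Term ℕ) : (groupTermEq G).Yes (p, q) ↔
    ∀ g : ℕ → G, ((signedWord p).map (signedValue g)).prod =
      ((signedWord q).map (signedValue g)).prod := by
  refine forall_congr' fun g => ?_
  rw [← realize_eq_signedWord, ← realize_eq_signedWord]

theorem termEq_semigroup_iff {S : Type*} [Semigroup S] (p q : semigroupLanguage.Term ℕ) :
    (semigroupTermEq S).Yes (p, q) ↔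
      ∀ e : ℕ → S, wordValue e (variableWord p) = wordValue e (variableWord q) := by
  refine forall_congr' fun e => ?_
  rw [← coe_realize, ← coe_realize, WithOne.coe_inj]

/-- The reduction of pairs of group terms to pairs of semigroup terms, on strings. -/
def substString (K : ℕ) (w : List GpSym) : List SgSym :=
  (emit (substWord K [] (fun x => true :: x) (readSigned false w) (readSigned true w)
    (readSigned false w))).map Sum.inl ++
  (emit (substWord K [] (fun x => true :: x) (readSigned false w) (readSigned true w)
    (readSigned true w))).map Sum.inr

theorem PT.substString (K : ℕ) : PT (substString K) := by
  have hc : PT (fun x : List Bool => true :: x) := (PT.const true).cons PT.id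
  have h0 := PT.readSigned false
  have h1 := PT.readSigned true
  exact (PT.map_emit Sum.inl (PT.substWord K [] hc h0 h1 h0)).append
    (PT.map_emit Sum.inr (PT.substWord K [] hc h0 h1 h1))

/-- The reduction of pairs of group terms to pairs of semigroup terms. -/
def substTerms (K : ℕ) (x : groupLanguage.Term ℕ × groupLanguage.Term ℕ) :
    semigroupLanguage.Term ℕ × semigroupLanguage.Term ℕ :=
  (wordTerm (substWord K 0 (fun n => 2 * n + 1) (signedWord x.1) (signedWord x.2)
    (signedWord x.1)),
  wordTerm (substWord K 0 (fun n => 2 * n + 1) (signedWord x.1) (signedWord x.2)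
    (signedWord x.2)))

theorem encode_substTerms (K : ℕ) (x : groupLanguage.Term ℕ × groupLanguage.Term ℕ) :
    (Computability.encodingProd (termEncoding semigroupLanguage)
      (termEncoding semigroupLanguage)).encode (substTerms K x) =
    substString K ((Computability.encodingProd (termEncoding groupLanguage)
      (termEncoding groupLanguage)).encode x) := by
  obtain ⟨p, q⟩ := x
  rw [substString, readSigned_encode, readSigned_encode, substWord_map, substWord_map]
  change List.map _ ((termEncoding semigroupLanguage).encode (wordTerm _)) ++
    List.map _ ((termEncoding semigroupLanguage).encode (wordTerm _)) = _
  rw [encode_wordTerm, encode_wordTerm, map_substWord, map_substWord]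
  simp only [encodeNat_two_mul_add_one]
  rfl

theorem groupTermEq_polyReduces [Finite G] [Nonempty I] (hM : IsRegularMatrix M) :
    PolyReduces (groupTermEq G) (semigroupTermEq (ReesMatrixSemigroup M)) := by
  obtain ⟨K, hK⟩ : ∃ K : ℕ, ∀ g : G, g ^ (K + 2) = 1 := by
    -- The exponent `K + 2` is twice the order of `G`; doubling keeps it at least `2` for trivial
    -- `G`.
    refine ⟨2 * Nat.card G - 2, fun g => ?_⟩
    have : 0 < Nat.card G := Nat.card_pos
    rw [show 2 * Nat.card G - 2 + 2 = Nat.card G * 2 by omega, pow_mul, pow_card_eq_one', one_pow]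
  refine ⟨substTerms K, (PT.substString K).nonempty_tm2 _ _ _ (encode_substTerms K), ?_⟩
  rintro ⟨p, q⟩
  rw [termEq_group_iff, substTerms, termEq_semigroup_iff, variableWord_wordTerm,
    variableWord_wordTerm]
  exact (forall_prod_substWord_iff hM hK (fun m n h => by simpa using h) (by simp) _ _).symm

/-- The test on the variables of two terms. -/
def termTest (rect one rows cols : Bool)
    (x : semigroupLanguage.Term ℕ × semigroupLanguage.Term ℕ) : Bool :=
  wordTest rect one rows cols [] ((variableWord x.1).map Computability.encodeNat)
    ((variableWord x.2).map Computability.encodeNat)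

/-- The test on the variables of two terms, on strings. -/
def stringTest (rect one rows cols : Bool) (w : List SgSym) : Bool :=
  wordTest rect one rows cols [] (readWord false w) (readWord true w)

theorem PT.stringTest (rect one rows cols : Bool) : PT (stringTest rect one rows cols) :=
  PT.wordTest (PTEq.of_finRep.list) rect one rows cols [] (PT.readWord false) (PT.readWord true)

theorem stringTest_encode (rect one rows cols : Bool)
    (x : semigroupLanguage.Term ℕ × semigroupLanguage.Term ℕ) :
    stringTest rect one rows cols ((Computability.encodingProd (termEncoding semigroupLanguage)
      (termEncoding semigroupLanguage)).encode x) = termTest rect one rows cols x := by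
  obtain ⟨p, q⟩ := x
  rw [stringTest, readWord_encode, readWord_encode]
  rfl

/-- Since `decodeNat` inverts `encodeNat`, every assignment factors through the names. The tests can
thus compare bit strings without computing indices. -/
theorem forall_comp_encodeNat {T : Type*} (F : (ℕ → T) → Prop) :
    (∀ e : ℕ → T, F e) ↔ ∀ e : List Bool → T, F fun n => e (Computability.encodeNat n) :=
  ⟨fun h _ => h _, fun h e => by simpa using h fun x => e (Computability.decodeNat x)⟩

/-- The criterion for equality of words, in terms of the names of the variables. -/
theorem exists_termTest [Nonempty I] (hM : IsRegularMatrix M) (h01 : IsZeroOneMatrix M) :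
    ∃ rect one rows cols : Bool, ∀ p q : semigroupLanguage.Term ℕ,
      (semigroupTermEq (ReesMatrixSemigroup M)).Yes (p, q) ↔
        termTest rect one rows cols (p, q) = true ∧
        ∀ g : ℕ → G, ((variableWord p).map g).prod = ((variableWord q).map g).prod := by
  obtain ⟨rect, one, rows, cols, h⟩ := exists_wordTest (R := fun l i => M l i ≠ 0) hM
  refine ⟨rect, one, rows, cols, fun p q => ?_⟩
  rw [termEq_semigroup_iff, forall_comp_encodeNat, forall_comp_encodeNat (T := G), termTest, h]
  have := ReesMatrixSemigroup.forall_wordValue_iff hM h01 ([] : List Bool)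
    (p := (variableWord p).map Computability.encodeNat)
    (q := (variableWord q).map Computability.encodeNat)
    (by simpa using variableWord_ne_nil p) (by simpa using variableWord_ne_nil q)
  simpa only [wordValue_map, List.map_map, Function.comp_def] using this

/-- The identity element as a group term. -/
def oneTerm : groupLanguage.Term ℕ := .func (GroupFunc.one : groupLanguage.Functions 0) ![]

/-- The reduction of pairs of semigroup terms to pairs of group terms. -/
def testTerms (rect one rows cols : Bool)
    (x : semigroupLanguage.Term ℕ × semigroupLanguage.Term ℕ) :
    groupLanguage.Term ℕ × groupLanguage.Term ℕ :=
  bif termTest rect one rows cols x then (groupLHom.onTerm x.1, groupLHom.onTerm x.2)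
  else (.var 0, oneTerm)

theorem encode_testTerms (rect one rows cols : Bool)
    (x : semigroupLanguage.Term ℕ × semigroupLanguage.Term ℕ) :
    (Computability.encodingProd (termEncoding groupLanguage)
      (termEncoding groupLanguage)).encode (testTerms rect one rows cols x) =
    (fun w : List SgSym => bif stringTest rect one rows cols w then w.map groupSymbol
      else (Computability.encodingProd (termEncoding groupLanguage)
        (termEncoding groupLanguage)).encode (.var 0, oneTerm))
      ((Computability.encodingProd (termEncoding semigroupLanguage)
        (termEncoding semigroupLanguage)).encode x) := by
  beta_reduce
  rw [stringTest_encode, testTerms]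
  cases termTest rect one rows cols x
  · rfl
  · change List.map _ ((termEncoding groupLanguage).encode (groupLHom.onTerm x.1)) ++
      List.map _ ((termEncoding groupLanguage).encode (groupLHom.onTerm x.2)) =
      List.map groupSymbol (List.map _ ((termEncoding semigroupLanguage).encode _) ++
        List.map _ ((termEncoding semigroupLanguage).encode _))
    rw [encode_onTerm, encode_onTerm]
    simp [groupSymbol, Function.comp_def]

/-- When the test succeeds, only equality over `G` is left, and the string changes just in its
operation symbols. When it fails, the output `x_0 = 1` is false because `G` is nontrivial. -/
theorem semigroupTermEq_polyReduces [Nontrivial G] [Nonempty I] (hM : IsRegularMatrix M)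
    (h01 : IsZeroOneMatrix M) :
    PolyReduces (semigroupTermEq (ReesMatrixSemigroup M)) (groupTermEq G) := by
  obtain ⟨rect, one, rows, cols, h⟩ := exists_termTest hM h01
  refine ⟨testTerms rect one rows cols, PT.nonempty_tm2 ((PT.stringTest rect one rows cols).cond
    (PT.map (f := fun _ => groupSymbol) PT.id ((PT.ofFin groupSymbol).comp PT.snd))
    (PT.const _)) _ _ _ (encode_testTerms rect one rows cols), ?_⟩
  rintro ⟨p, q⟩
  rw [h, testTerms]
  cases termTest rect one rows cols (p, q)
  · obtain ⟨g, hg⟩ := exists_ne (1 : G)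
    exact iff_of_false (fun h => by simpa using h.1) fun h => hg (h fun _ => g)
  · rw [eq_self_iff_true, true_and]
    refine forall_congr' fun g => ?_
    rw [← realize_onTerm, ← realize_onTerm]
    rfl

/-- Over a trivial group the remaining condition on products is void, so the test is the decision
procedure. -/
theorem inP_semigroupTermEq [Subsingleton G] [Nonempty I] (hM : IsRegularMatrix M)
    (h01 : IsZeroOneMatrix M) : InP (semigroupTermEq (ReesMatrixSemigroup M)) := by
  obtain ⟨rect, one, rows, cols, h⟩ := exists_termTest hM h01
  refine ⟨termTest rect one rows cols, PT.nonempty_tm2 ((PT.stringTest rect one rows cols).cons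
    (PT.const [])) _ _ _ fun x => congrArg (fun b => [b])
      (stringTest_encode rect one rows cols x).symm, ?_⟩
  rintro ⟨p, q⟩
  rw [h]
  exact and_iff_left fun g => Subsingleton.elim _ _

theorem inP_groupTermEq [Subsingleton G] : InP (groupTermEq G) :=
  ⟨fun _ => true, PT.nonempty_tm2 (A := GpSym) (PT.const [true]) _ _ _ fun _ => rfl,
    fun _ => iff_of_true (fun _ => Subsingleton.elim _ _) rfl⟩

end reductions
end TermEquivalence

theorem lemma5p2 {G : Type*} [Group G] [Finite G] {I Λ : Type*} [Finite I] [Finite Λ]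
    [Nonempty I] [Nonempty Λ] (M : Matrix Λ I (WithZero G))
    (hM : TermEquivalence.IsRegularMatrix M) :
    TermEquivalence.PolyReduces (TermEquivalence.groupTermEq G)
        (TermEquivalence.semigroupTermEq (TermEquivalence.ReesMatrixSemigroup M)) ∧
      (TermEquivalence.IsZeroOneMatrix M →
        (Nontrivial G →
          TermEquivalence.PolyEquivalent
            (TermEquivalence.semigroupTermEq (TermEquivalence.ReesMatrixSemigroup M))
            (TermEquivalence.groupTermEq G)) ∧
        (Subsingleton G →
          TermEquivalence.InP
              (TermEquivalence.semigroupTermEq (TermEquivalence.ReesMatrixSemigroup M)) ∧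
            TermEquivalence.InP (TermEquivalence.groupTermEq G))) := by
  refine ⟨TermEquivalence.groupTermEq_polyReduces hM, fun h01 => ⟨fun _ => ?_, fun _ => ?_⟩⟩
  · exact ⟨TermEquivalence.semigroupTermEq_polyReduces hM h01,
      TermEquivalence.groupTermEq_polyReduces hM⟩
  · exact ⟨TermEquivalence.inP_semigroupTermEq hM h01, TermEquivalence.inP_groupTermEq⟩
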